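/- Let $G=(V,E)$ be a finite simple graph on $n$ nodes and $T=(V,E_T)$ a spanning tree of $G$. For $f\in E\setminus E_T$ let $T_f$ be the path in $T$ between the endnodes of $f$, and for $F\subseteq E\setminus E_T$ let $T_F=\bigcup_{f\in F}T_f$ be the forest formed by the tree edges covered by $F$ (its nodes are the ends of these edges). In the Dominating Subtree problem the input is $G,T$ and the goal is to find a minimum-size $F\subseteq E\setminus E_T$ such that $T_F$ is a (non-empty) tree and every node of $G$ outside $T_F$ has a neighbor in $G$ that belongs to $T_F$. Theorem: the Dominating Subtree problem admits approximation ratio $O(\log n)$. That is, there are a constant $C$ and a deterministic algorithm that runs in time polynomial in $n$ on every instance and, on every instance that has a feasible solution, outputs a feasible $F$ with $|F|\le C\log n\cdot|F'|$ for every feasible solution $F'$. -/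

import Mathlib

/-! ### The Dominating Subtree problem -/

namespace DomSubtree

variable {V : Type*}

/-- `Covers T f e`: the edge `e` lies on a path of `T` between the two ends of `f`. For a tree `T`
this path is unique, and `{e | Covers T f e}` is its edge set `T_f`. -/
def Covers (T : SimpleGraph V) (f e : Sym2 V) : Prop :=
  ∃ (u v : V) (p : T.Walk u v), f = s(u, v) ∧ p.IsPath ∧ e ∈ p.edges

/-- The forest `T_F` formed by the edges of `T` that are covered by the members of `F`; its nodes
are the ends of these edges. -/
def coveredForest (T : SimpleGraph V) (F : Finset (Sym2 V)) : T.Subgraph where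
  verts := {v | ∃ w, ∃ f ∈ F, Covers T f s(v, w)}
  Adj v w := ∃ f ∈ F, Covers T f s(v, w)
  adj_sub := by
    rintro v w ⟨f, -, a, b, p, -, -, he⟩
    exact p.adj_of_mem_edges he
  edge_vert := fun {v w} h => ⟨w, h⟩
  symm := ⟨fun v w h => by rwa [Sym2.eq_swap]⟩

/-- `S` is a dominating set in `G`: every node outside `S` has a neighbor in `S`. -/
def IsDominating (G : SimpleGraph V) (S : Set V) : Prop :=
  ∀ v, v ∉ S → ∃ u ∈ S, G.Adj v u

/-- `F` is a feasible solution of the instance `G, T`: a set of non-tree edges of `G` such that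
`T_F` is a tree whose node set dominates `G`. -/
structure IsFeasible (G T : SimpleGraph V) (F : Finset (Sym2 V)) : Prop where
  subset : (F : Set (Sym2 V)) ⊆ G.edgeSet \ T.edgeSet
  tree : (coveredForest T F).coe.IsTree
  dominating : IsDominating G (coveredForest T F).verts

/-- `F` is feasible and its size is at most `ρ` times the minimum size of a feasible solution. -/
def IsApproxSolution (ρ : ℝ) (G T : SimpleGraph V) (F : Finset (Sym2 V)) : Prop :=
  IsFeasible G T F ∧ ∀ F', IsFeasible G T F' → (F.card : ℝ) ≤ ρ * (F'.card : ℝ)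

end DomSubtree

/-! ### Random access machines

Structured programs of a random access machine over the natural numbers, with unit cost for every
operation. There is no multiplication: values at most double in a step, so that polynomial time on
this machine is polynomial time on a Turing machine. -/

namespace RAM

/-- A memory: registers `x₀, x₁, …` and arrays `A₀, A₁, …` of unbounded length. A program only
mentions finitely many of them. -/
structure State where
  reg : ℕ → ℕ
  arr : ℕ → ℕ → ℕ

/-- Expressions: constants, registers, array entries, sums, and truncated differences. -/
inductive Term where
  | lit (c : ℕ)
  | reg (x : ℕ)
  | get (a : ℕ) (i : Term)
  | add (s t : Term)
  | sub (s t : Term)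

/-- The value of an expression. -/
def Term.eval (σ : State) : Term → ℕ
  | .lit c => c
  | .reg x => σ.reg x
  | .get a i => σ.arr a (i.eval σ)
  | .add s t => s.eval σ + t.eval σ
  | .sub s t => s.eval σ - t.eval σ

/-- The number of operations in the evaluation of an expression. -/
def Term.cost : Term → ℕ
  | .lit _ => 1
  | .reg _ => 1
  | .get _ i => i.cost + 1
  | .add s t => s.cost + t.cost + 1
  | .sub s t => s.cost + t.cost + 1

/-- Programs. A condition holds if its value is not `0`. -/
inductive Program where
  | skip
  | assign (x : ℕ) (e : Term)
  | store (a : ℕ) (i e : Term)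
  | seq (P Q : Program)
  | ite (c : Term) (P Q : Program)
  | loop (c : Term) (P : Program)

/-- The memory after `x := v`. -/
def State.setReg (σ : State) (x v : ℕ) : State :=
  { σ with reg := Function.update σ.reg x v }

/-- The memory after `A_a[i] := v`. -/
def State.setArr (σ : State) (a i v : ℕ) : State :=
  { σ with arr := Function.update σ.arr a (Function.update (σ.arr a) i v) }

/-- `Run P σ t τ`: started in the memory `σ`, the program `P` halts after `t` steps, and leaves
the memory `τ`. -/
inductive Run : Program → State → ℕ → State → Prop
  | skip (σ : State) : Run .skip σ 1 σ
  | assign (σ : State) (x : ℕ) (e : Term) :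
      Run (.assign x e) σ (e.cost + 1) (σ.setReg x (e.eval σ))
  | store (σ : State) (a : ℕ) (i e : Term) :
      Run (.store a i e) σ (i.cost + e.cost + 1) (σ.setArr a (i.eval σ) (e.eval σ))
  | seq {P Q : Program} {σ τ υ : State} {s t : ℕ} :
      Run P σ s τ → Run Q τ t υ → Run (.seq P Q) σ (s + t) υ
  | ite_true {c : Term} {P Q : Program} {σ τ : State} {t : ℕ} :
      c.eval σ ≠ 0 → Run P σ t τ → Run (.ite c P Q) σ (c.cost + 1 + t) τ
  | ite_false {c : Term} {P Q : Program} {σ τ : State} {t : ℕ} :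
      c.eval σ = 0 → Run Q σ t τ → Run (.ite c P Q) σ (c.cost + 1 + t) τ
  | loop_done {c : Term} {P : Program} {σ : State} :
      c.eval σ = 0 → Run (.loop c P) σ (c.cost + 1) σ
  | loop_step {c : Term} {P : Program} {σ τ υ : State} {s t : ℕ} :
      c.eval σ ≠ 0 → Run P σ s τ → Run (.loop c P) τ t υ →
        Run (.loop c P) σ (c.cost + 1 + s + t) υ

end RAM

/-! ### Polynomial time approximation -/

namespace DomSubtree

open Classical in
/-- The adjacency matrix of a graph, row by row, followed by zeros. -/
noncomputable def matrixArray {n : ℕ} (G : SimpleGraph (Fin n)) (i : ℕ) : ℕ :=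
  if ∃ u v : Fin n, i = (u : ℕ) * n + (v : ℕ) ∧ G.Adj u v then 1 else 0

/-- The memory that holds the instance `G, T`: the number of nodes in the register `x₀`, the
adjacency matrices of `G` and `T` in the arrays `A₀` and `A₁`, and `0` everywhere else. -/
noncomputable def inputState {n : ℕ} (G T : SimpleGraph (Fin n)) : RAM.State where
  reg x := if x = 0 then n else 0
  arr a := if a = 0 then matrixArray G else if a = 1 then matrixArray T else fun _ => 0

/-- The set of pairs of nodes that is read off the array `A₂`: the pair `uv` belongs to it if the
entry in row `u` and column `v`, or in row `v` and column `u`, is not `0`. -/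
def outputSet (n : ℕ) (σ : RAM.State) : Finset (Sym2 (Fin n)) :=
  ((Finset.univ : Finset (Fin n × Fin n)).filter
    fun q => σ.arr 2 ((q.1 : ℕ) * n + (q.2 : ℕ)) ≠ 0).image fun q => s(q.1, q.2)

/-- The problem admits approximation ratio `ρ(n)`: some program halts on every instance with `n`
nodes within polynomially many steps, and on every instance that has a feasible solution it outputs
one whose size is at most `ρ(n)` times the minimum. -/
def AdmitsRatio (ρ : ℕ → ℝ) : Prop :=
  ∃ (P : RAM.Program) (p : Polynomial ℕ),
    ∀ (n : ℕ) (G T : SimpleGraph (Fin n)), T ≤ G → T.IsTree →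
      ∃ (t : ℕ) (τ : RAM.State), RAM.Run P (inputState G T) t τ ∧ t ≤ p.eval n ∧
        ((∃ F, IsFeasible G T F) → IsApproxSolution (ρ n) G T (outputSet n τ))

end DomSubtree

/-! Call the edges of `G` outside `T` links. Root `T` at the neighbor `c` of a leaf `l`. A feasible
solution has to dominate `l`, so with at most one more link it covers `c` (`exists_feasible_root`).
Domination then becomes a covering problem: a link `q` hits a node `v` if the parent of `v` lies on
the path of `q`, or on the path of a link `uv` with `u` on the path of `q`. A solution through the
root hits every node (`hits_of_feasible`), and a connected family of links that hits every node is
feasible (`isFeasible_edges`). What is gained: two links that hit the same node are joined by a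
chain with at most two links in between, because the paths run into the same parent (`Hits.close`).

Let `O` be such a solution and `C` the current connected family; a member of `O` is touched if it
hits a node that `C` hits. Touched members are within three steps of `C`, and since `O` is
connected, some link within four steps hits a new node as long as one is left (`Cover.exists_gain`).
The greedy step takes the link within four steps that hits the most new nodes, together with three
connecting links. The potential of `C` sums over `O` the harmonic number of the count of new nodes a
member hits, plus `1` if it is untouched. Every gainful step lowers it by at least `1`
(`Cover.potential_drop`), and each summand is at most `harmonic n + 1`, so `C.card ≤ 1 + 4 * O.card
* (harmonic n + 1)`.

For the running time, the algorithm is written in a language whose only loops are bounded by `n` or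
`n * n`. Its commands compile to the machine with a polynomial bound (`Cmd.exists_program`), and the
tables they compute are verified in `stepCmd_spec` and `greedyCmd_spec`. -/

/-! ### Programs with bounded loops

A language of expressions with bounded sums and of commands with bounded iteration. It is compiled
to the random access machine, and every command runs in polynomial time. -/

namespace RAM

open Finset

/-- Started in `σ`, the program `P` halts within `s` steps in a memory that satisfies `Q`. -/
def Halts (P : Program) (σ : State) (s : ℕ) (Q : State → Prop) : Prop :=
  ∃ t τ, Run P σ t τ ∧ t ≤ s ∧ Q τ

namespace Halts

variable {P P' : Program} {σ : State} {s s' : ℕ} {Q Q' : State → Prop}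

theorem mono (h : Halts P σ s Q) (hs : s ≤ s') (hQ : ∀ τ, Q τ → Q' τ) : Halts P σ s' Q' := by
  obtain ⟨t, τ, hr, ht, hq⟩ := h
  exact ⟨t, τ, hr, ht.trans hs, hQ τ hq⟩

theorem seq (h : Halts P σ s Q) (h' : ∀ τ, Q τ → Halts P' τ s' Q') :
    Halts (.seq P P') σ (s + s') Q' := by
  obtain ⟨t, τ, hr, ht, hq⟩ := h
  obtain ⟨t', τ', hr', ht', hq'⟩ := h' τ hq
  exact ⟨t + t', τ', .seq hr hr', by omega, hq'⟩

theorem skip (h : Q σ) : Halts .skip σ 1 Q := ⟨1, σ, .skip σ, le_rfl, h⟩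

theorem assign {x : ℕ} {e : Term} (h : Q (σ.setReg x (e.eval σ))) :
    Halts (.assign x e) σ (e.cost + 1) Q := ⟨_, _, .assign σ x e, le_rfl, h⟩

theorem store {a : ℕ} {i e : Term} (h : Q (σ.setArr a (i.eval σ) (e.eval σ))) :
    Halts (.store a i e) σ (i.cost + e.cost + 1) Q := ⟨_, _, .store σ a i e, le_rfl, h⟩

theorem ite {c : Term} (ht : c.eval σ ≠ 0 → Halts P σ s Q) (hf : c.eval σ = 0 → Halts P' σ s Q) :
    Halts (.ite c P P') σ (c.cost + 1 + s) Q := by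
  by_cases hc : c.eval σ = 0
  · obtain ⟨t, τ, hr, hts, hq⟩ := hf hc
    exact ⟨_, τ, .ite_false hc hr, by omega, hq⟩
  · obtain ⟨t, τ, hr, hts, hq⟩ := ht hc
    exact ⟨_, τ, .ite_true hc hr, by omega, hq⟩

/-- The invariant is indexed by the number of completed rounds, so `B` is their exact number; the
extra `1` in `B + 1` pays for the last, failing test. -/
theorem loop {c : Term} {I : ℕ → State → Prop} {B : ℕ}
    (hstep : ∀ k < B, ∀ σ, I k σ → c.eval σ ≠ 0 ∧ Halts P σ s (I (k + 1)))
    (hdone : ∀ σ, I B σ → c.eval σ = 0) (h : I 0 σ) :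
    Halts (.loop c P) σ ((B + 1) * (c.cost + 1 + s)) (I B) := by
  have key : ∀ j k σ, k + j = B → I k σ →
      Halts (.loop c P) σ ((j + 1) * (c.cost + 1 + s)) (I B) := by
    intro j
    induction j with
    | zero =>
      intro k σ hk hI
      obtain rfl : k = B := by omega
      exact ⟨_, σ, .loop_done (hdone σ hI), by omega, hI⟩
    | succ j ih =>
      intro k σ hk hI
      obtain ⟨hc, t, τ, hr, ht, hI'⟩ := hstep k (by omega) σ hI
      obtain ⟨t', τ', hr', ht', hQ⟩ := ih (k + 1) τ (by omega) hI'
      refine ⟨_, τ', .loop_step hc hr hr', ?_, hQ⟩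
      have : (j + 1 + 1) * (c.cost + 1 + s) = (j + 1) * (c.cost + 1 + s) + (c.cost + 1 + s) := by
        ring
      omega
  exact key B 0 σ (by omega) h

end Halts

/-- The first argument at which `f` attains its maximum on `{0, …, N - 1}`. -/
def firstMax (f : ℕ → ℕ) : ℕ → ℕ × ℕ
  | 0 => (0, 0)
  | N + 1 => if (firstMax f N).2 < f N then (N, f N) else firstMax f N

theorem le_firstMax (f : ℕ → ℕ) (N : ℕ) : ∀ i < N, f i ≤ (firstMax f N).2 := by
  induction N with
  | zero => simp
  | succ N ih =>
    intro i hi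
    rw [firstMax]
    rcases Nat.lt_succ_iff_lt_or_eq.1 hi with h | rfl
    · have := ih i h
      split_ifs
      · exact (this.trans_lt (by assumption)).le
      · exact this
    · split_ifs
      · exact le_rfl
      · omega

theorem firstMax_spec (f : ℕ → ℕ) {N : ℕ} (hN : 0 < N) :
    (firstMax f N).1 < N ∧ (firstMax f N).2 = f (firstMax f N).1 := by
  induction N with
  | zero => omega
  | succ N ih =>
    rw [firstMax]
    rcases Nat.eq_zero_or_pos N with rfl | h
    · split_ifs with h0 <;> simp [firstMax] at h0 ⊢
      omega
    · obtain ⟨h1, h2⟩ := ih h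
      split_ifs
      · simp
      · exact ⟨by omega, h2⟩

/-! ### Syntax and meaning of the bounded language -/

/-- Expressions with variables, arrays, and sums and maxima over the numbers below `n` (`false`) or
below `n * n` (`true`). -/
inductive Exp where
  | lit (c : ℕ)
  | var (x : ℕ)
  | get (a : ℕ) (e : Exp)
  | add (e f : Exp)
  | sub (e f : Exp)
  | sum (b : Bool) (x : ℕ) (e : Exp)
  | argmax (b : Bool) (x : ℕ) (e : Exp)

/-- The two ranges of bounded loops. -/
def bound (n : ℕ) : Bool → ℕ
  | false => n
  | true => n * n

/-- The value of an expression. -/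
def Exp.eval (n : ℕ) (A : ℕ → ℕ → ℕ) : Exp → (ℕ → ℕ) → ℕ
  | .lit c, _ => c
  | .var x, ρ => ρ x
  | .get a e, ρ => A a (e.eval n A ρ)
  | .add e f, ρ => e.eval n A ρ + f.eval n A ρ
  | .sub e f, ρ => e.eval n A ρ - f.eval n A ρ
  | .sum b x e, ρ => ∑ i ∈ range (bound n b), e.eval n A (Function.update ρ x i)
  | .argmax b x e, ρ => (firstMax (fun i => e.eval n A (Function.update ρ x i)) (bound n b)).1

/-- Commands: assignment to a variable, tabulation of an array, composition, and iteration. -/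
inductive Cmd where
  | set (x : ℕ) (e : Exp)
  | tab (b : Bool) (a x : ℕ) (e : Exp)
  | seq (c d : Cmd)
  | rep (c : Cmd)

/-- Variables and arrays. -/
abbrev Mem := (ℕ → ℕ) × (ℕ → ℕ → ℕ)

/-- The effect of a command. -/
def Cmd.exec (n : ℕ) : Cmd → Mem → Mem
  | .set x e, m => (Function.update m.1 x (e.eval n m.2 m.1), m.2)
  | .tab b a x e, m => (m.1, Function.update m.2 a fun i =>
      if i < bound n b then e.eval n m.2 (Function.update m.1 x i) else m.2 a i)
  | .seq c d, m => d.exec n (c.exec n m)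
  | .rep c, m => (c.exec n)^[n] m

/-! ### Memory layout -/

/-- The number of the machine array that holds the array `a`; the array `3` is auxiliary. -/
def slot (a : ℕ) : ℕ := if a < 3 then a else a + 1

theorem slot_ne_three (a : ℕ) : slot a ≠ 3 := by unfold slot; split_ifs <;> omega

theorem slot_inj {a b : ℕ} : slot a = slot b ↔ a = b := by unfold slot; split_ifs <;> omega

/-- The machine register that holds the bound of a loop. -/
def boundReg : Bool → ℕ
  | false => 0
  | true => 1

/-- The memory `σ` represents the variables `ρ` and the arrays `A`. -/
structure Rep (n : ℕ) (ρ : ℕ → ℕ) (A : ℕ → ℕ → ℕ) (σ : State) : Prop where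
  bound : ∀ b, σ.reg (boundReg b) = bound n b
  var : ∀ x, σ.reg (2 * x + 2) = ρ x
  arr : ∀ a, σ.arr (slot a) = A a

theorem boundReg_lt (b : Bool) : boundReg b < 2 := by cases b <;> decide

theorem setReg_reg (σ : State) (x v y : ℕ) :
    (σ.setReg x v).reg y = if y = x then v else σ.reg y := by
  simp [State.setReg, Function.update_apply]

@[simp] theorem setReg_arr (σ : State) (x v : ℕ) : (σ.setReg x v).arr = σ.arr := rfl

@[simp] theorem setArr_reg (σ : State) (a i v : ℕ) : (σ.setArr a i v).reg = σ.reg := rfl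

theorem setArr_arr (σ : State) (a i v b : ℕ) :
    (σ.setArr a i v).arr b = if b = a then Function.update (σ.arr a) i v else σ.arr b := by
  simp only [State.setArr, Function.update_apply]

section Rep

variable {n : ℕ} {ρ : ℕ → ℕ} {A : ℕ → ℕ → ℕ} {σ : State}

/-- Registers `0` and `1` hold `n` and `n * n`, the even ones from `2` on hold the variables, and
the odd ones from `3` on form a stack of accumulators. Hence writing to the stack does not affect
the represented memory. -/
theorem Rep.setAcc (h : Rep n ρ A σ) (d v : ℕ) : Rep n ρ A (σ.setReg (2 * d + 3) v) where
  bound b := by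
    have := boundReg_lt b
    rw [setReg_reg, if_neg (by omega), h.bound]
  var x := by rw [setReg_reg, if_neg (by omega), h.var]
  arr := h.arr

theorem Rep.setVar (h : Rep n ρ A σ) (x v : ℕ) :
    Rep n (Function.update ρ x v) A (σ.setReg (2 * x + 2) v) where
  bound b := by
    have := boundReg_lt b
    rw [setReg_reg, if_neg (by omega), h.bound]
  var y := by
    rw [setReg_reg, Function.update_apply, h.var]
    congr 1
    simp
  arr := h.arr

end Rep

/-! ### Compilation of expressions -/

/-- The code that computes the value of an expression in the register `2 * d + 3`. -/
def Exp.code : Exp → ℕ → Program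
  | .lit c, d => .assign (2 * d + 3) (.lit c)
  | .var x, d => .assign (2 * d + 3) (.reg (2 * x + 2))
  | .get a e, d => .seq (e.code d) (.assign (2 * d + 3) (.get (slot a) (.reg (2 * d + 3))))
  | .add e f, d => .seq (e.code d) (.seq (f.code (d + 1))
      (.assign (2 * d + 3) (.add (.reg (2 * d + 3)) (.reg (2 * (d + 1) + 3)))))
  | .sub e f, d => .seq (e.code d) (.seq (f.code (d + 1))
      (.assign (2 * d + 3) (.sub (.reg (2 * d + 3)) (.reg (2 * (d + 1) + 3)))))
  | .sum b x e, d =>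
      .seq (.assign (2 * (d + 1) + 3) (.reg (2 * x + 2))) <|
      .seq (.assign (2 * d + 3) (.lit 0)) <|
      .seq (.assign (2 * x + 2) (.lit 0)) <|
      .seq (.loop (.sub (.reg (boundReg b)) (.reg (2 * x + 2))) <|
        .seq (e.code (d + 2)) <|
        .seq (.assign (2 * d + 3) (.add (.reg (2 * d + 3)) (.reg (2 * (d + 2) + 3)))) <|
        .assign (2 * x + 2) (.add (.reg (2 * x + 2)) (.lit 1))) <|
      .assign (2 * x + 2) (.reg (2 * (d + 1) + 3))
  | .argmax b x e, d =>
      .seq (.assign (2 * (d + 1) + 3) (.reg (2 * x + 2))) <|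
      .seq (.assign (2 * d + 3) (.lit 0)) <|
      .seq (.assign (2 * (d + 2) + 3) (.lit 0)) <|
      .seq (.assign (2 * x + 2) (.lit 0)) <|
      .seq (.loop (.sub (.reg (boundReg b)) (.reg (2 * x + 2))) <|
        .seq (e.code (d + 3)) <|
        .seq (.ite (.sub (.reg (2 * (d + 3) + 3)) (.reg (2 * (d + 2) + 3)))
          (.seq (.assign (2 * (d + 2) + 3) (.reg (2 * (d + 3) + 3)))
            (.assign (2 * d + 3) (.reg (2 * x + 2)))) .skip) <|
        .assign (2 * x + 2) (.add (.reg (2 * x + 2)) (.lit 1))) <|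
      .assign (2 * x + 2) (.reg (2 * (d + 1) + 3))

/-- The accumulators below `d` agree in both memories. -/
def SameBelow (d : ℕ) (σ τ : State) : Prop := ∀ j < d, τ.reg (2 * j + 3) = σ.reg (2 * j + 3)

/-- The memory after the evaluation of an expression at depth `d`. -/
structure Post (n : ℕ) (ρ : ℕ → ℕ) (A : ℕ → ℕ → ℕ) (d : ℕ) (σ : State) (v : ℕ) (τ : State) :
    Prop where
  rep : Rep n ρ A τ
  arr : τ.arr = σ.arr
  below : SameBelow d σ τ
  val : τ.reg (2 * d + 3) = v

/-- The polynomial that bounds the length of a loop. -/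
noncomputable def boundPoly : Bool → Polynomial ℕ
  | false => .X
  | true => .X * .X

@[simp] theorem eval_boundPoly (n : ℕ) (b : Bool) : (boundPoly b).eval n = bound n b := by
  cases b <;> simp [boundPoly, bound]

/-- Code at depth `d` leaves the accumulators below `d`, the variables and the arrays as it found
them, so an operand survives the evaluation of the next one at greater depth. One polynomial serves
all depths and memories. -/
theorem Exp.halts_code (e : Exp) : ∃ p : Polynomial ℕ, ∀ n ρ A d σ, Rep n ρ A σ →
    Halts (e.code d) σ (p.eval n) (Post n ρ A d σ (e.eval n A ρ)) := by
  induction e with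
  | lit c =>
    refine ⟨2, fun n ρ A d σ h => ?_⟩
    refine (Halts.assign (Q := Post n ρ A d σ ((Exp.lit c).eval n A ρ)) ?_).mono
      (by simp [Term.cost]) fun _ h => h
    exact ⟨h.setAcc _ _, rfl, fun j hj => by rw [setReg_reg, if_neg (by omega)],
      by simp [setReg_reg, Term.eval, Exp.eval]⟩
  | var x =>
    refine ⟨2, fun n ρ A d σ h => ?_⟩
    refine (Halts.assign (Q := Post n ρ A d σ ((Exp.var x).eval n A ρ)) ?_).mono
      (by simp [Term.cost]) fun _ h => h
    exact ⟨h.setAcc _ _, rfl, fun j hj => by rw [setReg_reg, if_neg (by omega)],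
      by simp [setReg_reg, Term.eval, Exp.eval, h.var]⟩
  | get a e ih =>
    obtain ⟨p, hp⟩ := ih
    refine ⟨p + 3, fun n ρ A d σ h => ?_⟩
    refine ((hp n ρ A d σ h).seq (s' := 3) fun τ hτ => ?_).mono (by simp) fun _ h => h
    refine (Halts.assign (Q := Post n ρ A d σ ((Exp.get a e).eval n A ρ)) ?_).mono
      (by simp [Term.cost]) fun _ h => h
    refine ⟨hτ.rep.setAcc _ _, hτ.arr, fun j hj => ?_, ?_⟩
    · rw [setReg_reg, if_neg (by omega), hτ.below j hj]
    · simp [setReg_reg, Term.eval, Exp.eval, hτ.rep.arr, hτ.val]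
  | add e f ihe ihf =>
    obtain ⟨p, hp⟩ := ihe
    obtain ⟨q, hq⟩ := ihf
    refine ⟨p + (q + 4), fun n ρ A d σ h => ?_⟩
    refine ((hp n ρ A d σ h).seq (s' := q.eval n + 4) fun τ hτ => ?_).mono
      (by simp) fun _ h => h
    refine (hq n ρ A (d + 1) τ hτ.rep).seq fun υ hυ => ?_
    refine (Halts.assign (Q := Post n ρ A d σ ((Exp.add e f).eval n A ρ)) ?_).mono
      (by simp [Term.cost]) fun _ h => h
    refine ⟨hυ.rep.setAcc _ _, hυ.arr.trans hτ.arr, fun j hj => ?_, ?_⟩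
    · rw [setReg_reg, if_neg (by omega), hυ.below j (by omega), hτ.below j hj]
    · simp [setReg_reg, Term.eval, Exp.eval, hυ.val, hυ.below d (by omega), hτ.val]
  | sub e f ihe ihf =>
    obtain ⟨p, hp⟩ := ihe
    obtain ⟨q, hq⟩ := ihf
    refine ⟨p + (q + 4), fun n ρ A d σ h => ?_⟩
    refine ((hp n ρ A d σ h).seq (s' := q.eval n + 4) fun τ hτ => ?_).mono
      (by simp) fun _ h => h
    refine (hq n ρ A (d + 1) τ hτ.rep).seq fun υ hυ => ?_
    refine (Halts.assign (Q := Post n ρ A d σ ((Exp.sub e f).eval n A ρ)) ?_).mono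
      (by simp [Term.cost]) fun _ h => h
    refine ⟨hυ.rep.setAcc _ _, hυ.arr.trans hτ.arr, fun j hj => ?_, ?_⟩
    · rw [setReg_reg, if_neg (by omega), hυ.below j (by omega), hτ.below j hj]
    · simp [setReg_reg, Term.eval, Exp.eval, hυ.val, hυ.below d (by omega), hτ.val]
  | sum b x e ih =>
    obtain ⟨p, hp⟩ := ih
    refine ⟨2 + (2 + (2 + ((boundPoly b + 1) * (4 + (p + 8)) + 2))), fun n ρ A d σ h => ?_⟩
    set f : ℕ → ℕ := fun i => e.eval n A (Function.update ρ x i) with hf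
    -- The summation variable is itself the loop counter. Its old value waits in the accumulator `d
    -- + 1`, to be restored at the end, so the body runs at depth `d + 2`.
    let I : ℕ → State → Prop := fun k τ => Rep n (Function.update ρ x k) A τ ∧ τ.arr = σ.arr ∧
      SameBelow d σ τ ∧ τ.reg (2 * (d + 1) + 3) = ρ x ∧ τ.reg (2 * d + 3) = ∑ i ∈ range k, f i
    have hinit : I 0 (((σ.setReg (2 * (d + 1) + 3) (ρ x)).setReg (2 * d + 3) 0).setReg
        (2 * x + 2) 0) := by
      refine ⟨((h.setAcc _ _).setAcc _ _).setVar _ _, rfl, fun j hj => ?_, ?_, ?_⟩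
      · rw [setReg_reg, if_neg (by omega), setReg_reg, if_neg (by omega), setReg_reg,
          if_neg (by omega)]
      · rw [setReg_reg, if_neg (by omega), setReg_reg, if_neg (by omega), setReg_reg, if_pos rfl]
      · rw [setReg_reg, if_neg (by omega), setReg_reg, if_pos rfl, range_zero, sum_empty]
    have hloop : ∀ τ, I 0 τ → Halts (.loop (.sub (.reg (boundReg b)) (.reg (2 * x + 2))) <|
        .seq (e.code (d + 2)) <|
        .seq (.assign (2 * d + 3) (.add (.reg (2 * d + 3)) (.reg (2 * (d + 2) + 3)))) <|
        .assign (2 * x + 2) (.add (.reg (2 * x + 2)) (.lit 1))) τ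
        ((bound n b + 1) * (3 + 1 + (p.eval n + 8))) (I (bound n b)) := by
      intro τ hτ
      refine Halts.loop ?_ ?_ hτ
      · rintro k hk τ ⟨hrep, harr, hbel, hsave, hacc⟩
        refine ⟨?_, ?_⟩
        · simp only [Term.eval, hrep.bound, hrep.var, Function.update_self]
          omega
        refine (hp n _ A (d + 2) τ hrep).seq fun υ hυ => ?_
        refine (Halts.seq (Halts.assign (Q := fun ω => Rep n (Function.update ρ x k) A ω ∧
          ω.arr = σ.arr ∧ SameBelow d σ ω ∧ ω.reg (2 * (d + 1) + 3) = ρ x ∧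
          ω.reg (2 * d + 3) = ∑ i ∈ range (k + 1), f i) ?_) (s' := 4) ?_).mono
          (by simp [Term.cost]) fun _ h => h
        · refine ⟨hυ.rep.setAcc _ _, hυ.arr.trans harr, fun j hj => ?_, ?_, ?_⟩
          · rw [setReg_reg, if_neg (by omega), hυ.below j (by omega), hbel j hj]
          · rw [setReg_reg, if_neg (by omega), hυ.below _ (by omega), hsave]
          · rw [setReg_reg, if_pos rfl, sum_range_succ]
            simp only [Term.eval, hυ.val, hυ.below d (by omega), hacc, hf]
        · rintro ω ⟨hrep', harr', hbel', hsave', hacc'⟩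
          refine (Halts.assign ?_).mono (by simp [Term.cost]) fun _ h => h
          have hv : (Term.add (.reg (2 * x + 2)) (.lit 1)).eval ω = k + 1 := by
            simp [Term.eval, hrep'.var]
          rw [hv]
          refine ⟨?_, harr', fun j hj => ?_, ?_, ?_⟩
          · simpa using hrep'.setVar x (k + 1)
          · rw [setReg_reg, if_neg (by omega), hbel' j hj]
          · rw [setReg_reg, if_neg (by omega), hsave']
          · rw [setReg_reg, if_neg (by omega), hacc']
      · rintro τ ⟨hrep, -⟩
        simp [Term.eval, hrep.bound, hrep.var]
    refine ((Halts.assign (Q := fun τ => τ = σ.setReg (2 * (d + 1) + 3) (ρ x)) ?_).seq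
      fun τ hτ => ((Halts.assign (Q := fun τ => τ =
        (σ.setReg (2 * (d + 1) + 3) (ρ x)).setReg (2 * d + 3) 0) ?_).seq fun τ hτ =>
        (Halts.assign (Q := I 0) ?_).seq fun τ hτ => (hloop τ hτ).seq fun τ hτ =>
        Halts.assign ?_)).mono
      (by simp [Term.cost]) fun _ h => h
    · simp [Term.eval, h.var]
    · simp [hτ, Term.eval]
    · simpa [hτ, Term.eval] using hinit
    · obtain ⟨hrep, harr, hbel, hsave, hacc⟩ := hτ
      refine ⟨?_, harr, fun j hj => ?_, ?_⟩
      · simpa [Term.eval, hsave] using hrep.setVar x (ρ x)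
      · rw [setReg_reg, if_neg (by omega), hbel j hj]
      · rw [setReg_reg, if_neg (by omega), hacc, Exp.eval]
  | argmax b x e ih =>
    obtain ⟨p, hp⟩ := ih
    refine ⟨2 + (2 + (2 + (2 + ((boundPoly b + 1) * (4 + (p + 12)) + 2)))),
      fun n ρ A d σ h => ?_⟩
    set f : ℕ → ℕ := fun i => e.eval n A (Function.update ρ x i) with hf
    -- The counter `k` and the length `l` of the scanned prefix are separate, since they differ
    -- between the update of the maximum and the increment of the counter.
    let J : ℕ → ℕ → State → Prop := fun k l τ => Rep n (Function.update ρ x k) A τ ∧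
      τ.arr = σ.arr ∧ SameBelow d σ τ ∧ τ.reg (2 * (d + 1) + 3) = ρ x ∧
      τ.reg (2 * d + 3) = (firstMax f l).1 ∧ τ.reg (2 * (d + 2) + 3) = (firstMax f l).2
    have hinit : J 0 0 ((((σ.setReg (2 * (d + 1) + 3) (ρ x)).setReg (2 * d + 3) 0).setReg
        (2 * (d + 2) + 3) 0).setReg (2 * x + 2) 0) := by
      refine ⟨(((h.setAcc _ _).setAcc _ _).setAcc _ _).setVar _ _, rfl, fun j hj => ?_, ?_, ?_, ?_⟩
      · rw [setReg_reg, if_neg (by omega), setReg_reg, if_neg (by omega), setReg_reg,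
          if_neg (by omega), setReg_reg, if_neg (by omega)]
      · rw [setReg_reg, if_neg (by omega), setReg_reg, if_neg (by omega), setReg_reg,
          if_neg (by omega), setReg_reg, if_pos rfl]
      · rw [setReg_reg, if_neg (by omega), setReg_reg, if_neg (by omega), setReg_reg,
          if_pos rfl, firstMax]
      · rw [setReg_reg, if_neg (by omega), setReg_reg, if_pos rfl, firstMax]
    have hloop : ∀ τ, J 0 0 τ → Halts (.loop (.sub (.reg (boundReg b)) (.reg (2 * x + 2))) <|
        .seq (e.code (d + 3)) <|
        .seq (.ite (.sub (.reg (2 * (d + 3) + 3)) (.reg (2 * (d + 2) + 3)))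
          (.seq (.assign (2 * (d + 2) + 3) (.reg (2 * (d + 3) + 3)))
            (.assign (2 * d + 3) (.reg (2 * x + 2)))) .skip) <|
        .assign (2 * x + 2) (.add (.reg (2 * x + 2)) (.lit 1))) τ
        ((bound n b + 1) * (3 + 1 + (p.eval n + 12))) (J (bound n b) (bound n b)) := by
      intro τ hτ
      refine Halts.loop (I := fun k => J k k) ?_ ?_ hτ
      · rintro k hk τ ⟨hrep, harr, hbel, hsave, harg, hmax⟩
        refine ⟨?_, ?_⟩
        · simp only [Term.eval, hrep.bound, hrep.var, Function.update_self]
          omega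
        refine (hp n _ A (d + 3) τ hrep).seq fun υ hυ => ?_
        have hbel1 : SameBelow d σ υ := fun j hj => by rw [hυ.below j (by omega), hbel j hj]
        have hsave1 : υ.reg (2 * (d + 1) + 3) = ρ x := by rw [hυ.below _ (by omega), hsave]
        have hval1 : υ.reg (2 * (d + 3) + 3) = f k := hυ.val
        have harg1 : υ.reg (2 * d + 3) = (firstMax f k).1 := by rw [hυ.below _ (by omega), harg]
        have hmax1 : υ.reg (2 * (d + 2) + 3) = (firstMax f k).2 := by
          rw [hυ.below _ (by omega), hmax]
        refine (Halts.seq (s := 8) (s' := 4) (Q := J k (k + 1)) ?_ ?_)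
        · refine (Halts.ite (s := 4) (fun hc => ?_) (fun hc => ?_)).mono
            (by simp [Term.cost]) fun _ h => h
          · refine ((Halts.assign (Q := fun ω => ω = υ.setReg (2 * (d + 2) + 3) (f k)) ?_).seq
              fun ω hω => Halts.assign ?_).mono (by simp [Term.cost]) fun _ h => h
            · simp [Term.eval, hυ.val, hf]
            · have hlt : (firstMax f k).2 < f k := by
                simp only [Term.eval, hval1, hmax1] at hc
                omega
              subst hω
              have hv : (Term.reg (2 * x + 2)).eval (υ.setReg (2 * (d + 2) + 3) (f k)) = k := by
                simp [Term.eval, (hυ.rep.setAcc (d + 2) (f k)).var]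
              rw [hv]
              refine ⟨(hυ.rep.setAcc _ _).setAcc _ _, hυ.arr.trans harr, fun j hj => ?_, ?_, ?_, ?_⟩
              · rw [setReg_reg, if_neg (by omega), setReg_reg, if_neg (by omega), hbel1 j hj]
              · rw [setReg_reg, if_neg (by omega), setReg_reg, if_neg (by omega), hsave1]
              · rw [setReg_reg, if_pos rfl, firstMax, if_pos hlt]
              · rw [setReg_reg, if_neg (by omega), setReg_reg, if_pos rfl, firstMax, if_pos hlt]
          · refine (Halts.skip ?_).mono (by omega) fun _ h => h
            have hlt : ¬ (firstMax f k).2 < f k := by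
              simp only [Term.eval, hval1, hmax1] at hc
              omega
            refine ⟨hυ.rep, hυ.arr.trans harr, hbel1, hsave1, ?_, ?_⟩
            · rw [firstMax, if_neg hlt, harg1]
            · rw [firstMax, if_neg hlt, hmax1]
        · rintro ω ⟨hrep', harr', hbel', hsave', harg', hmax'⟩
          refine (Halts.assign ?_).mono (by simp [Term.cost]) fun _ h => h
          have hv : (Term.add (.reg (2 * x + 2)) (.lit 1)).eval ω = k + 1 := by
            simp [Term.eval, hrep'.var]
          rw [hv]
          refine ⟨?_, harr', fun j hj => ?_, ?_, ?_, ?_⟩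
          · simpa using hrep'.setVar x (k + 1)
          · rw [setReg_reg, if_neg (by omega), hbel' j hj]
          · rw [setReg_reg, if_neg (by omega), hsave']
          · rw [setReg_reg, if_neg (by omega), harg']
          · rw [setReg_reg, if_neg (by omega), hmax']
      · rintro τ ⟨hrep, -⟩
        simp [Term.eval, hrep.bound, hrep.var]
    refine ((Halts.assign (Q := fun τ => τ = σ.setReg (2 * (d + 1) + 3) (ρ x)) ?_).seq
      fun τ hτ => ((Halts.assign (Q := fun τ => τ =
        (σ.setReg (2 * (d + 1) + 3) (ρ x)).setReg (2 * d + 3) 0) ?_).seq fun τ hτ =>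
        (Halts.assign (Q := fun τ => τ = ((σ.setReg (2 * (d + 1) + 3) (ρ x)).setReg
          (2 * d + 3) 0).setReg (2 * (d + 2) + 3) 0) ?_).seq fun τ hτ =>
        (Halts.assign (Q := J 0 0) ?_).seq fun τ hτ => (hloop τ hτ).seq fun τ hτ =>
        Halts.assign ?_)).mono
      (by simp [Term.cost]) fun _ h => h
    · simp [Term.eval, h.var]
    · simp [hτ, Term.eval]
    · simp [hτ, Term.eval]
    · simpa [hτ, Term.eval] using hinit
    · obtain ⟨hrep, harr, hbel, hsave, harg, -⟩ := hτ
      refine ⟨?_, harr, fun j hj => ?_, ?_⟩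
      · simpa [Term.eval, hsave] using hrep.setVar x (ρ x)
      · rw [setReg_reg, if_neg (by omega), hbel j hj]
      · rw [setReg_reg, if_neg (by omega), harg, Exp.eval]

/-! ### Compilation of commands -/

/-- The code of a command, at depth `d`. -/
def Cmd.code : Cmd → ℕ → Program
  | .set x e, d => .seq (e.code d) (.assign (2 * x + 2) (.reg (2 * d + 3)))
  | .tab b a x e, d =>
      .seq (.assign (2 * d + 3) (.reg (2 * x + 2))) <|
      .seq (.assign (2 * x + 2) (.lit 0)) <|
      .seq (.loop (.sub (.reg (boundReg b)) (.reg (2 * x + 2))) <|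
        .seq (e.code (d + 1)) <|
        .seq (.store 3 (.reg (2 * x + 2)) (.reg (2 * (d + 1) + 3))) <|
        .assign (2 * x + 2) (.add (.reg (2 * x + 2)) (.lit 1))) <|
      .seq (.assign (2 * x + 2) (.lit 0)) <|
      .seq (.loop (.sub (.reg (boundReg b)) (.reg (2 * x + 2))) <|
        .seq (.store (slot a) (.reg (2 * x + 2)) (.get 3 (.reg (2 * x + 2)))) <|
        .assign (2 * x + 2) (.add (.reg (2 * x + 2)) (.lit 1))) <|
      .assign (2 * x + 2) (.reg (2 * d + 3))
  | .seq c c', d => .seq (c.code d) (c'.code d)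
  | .rep c, d =>
      .seq (.assign (2 * d + 3) (.reg 0)) <|
      .loop (.reg (2 * d + 3)) <|
        .seq (c.code (d + 1)) <|
        .assign (2 * d + 3) (.sub (.reg (2 * d + 3)) (.lit 1))

section Rep

variable {n : ℕ} {ρ : ℕ → ℕ} {A : ℕ → ℕ → ℕ} {σ : State}

theorem Rep.setAux (h : Rep n ρ A σ) (i v : ℕ) : Rep n ρ A (σ.setArr 3 i v) where
  bound := h.bound
  var := h.var
  arr a := by rw [setArr_arr, if_neg (slot_ne_three a), h.arr]

theorem Rep.setArr (h : Rep n ρ A σ) (a i v : ℕ) :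
    Rep n ρ (Function.update A a (Function.update (A a) i v)) (σ.setArr (slot a) i v) where
  bound := h.bound
  var := h.var
  arr b := by
    rw [setArr_arr, Function.update_apply, h.arr, h.arr]
    simp only [slot_inj]

end Rep

theorem Cmd.halts_code (c : Cmd) : ∃ p : Polynomial ℕ, ∀ n m d σ, Rep n m.1 m.2 σ →
    Halts (c.code d) σ (p.eval n)
      (fun τ => Rep n (c.exec n m).1 (c.exec n m).2 τ ∧ SameBelow d σ τ) := by
  induction c with
  | set x e =>
    obtain ⟨p, hp⟩ := e.halts_code
    refine ⟨p + 2, fun n m d σ h => ?_⟩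
    refine ((hp n m.1 m.2 d σ h).seq (s' := 2) fun τ hτ => ?_).mono (by simp) fun _ h => h
    refine (Halts.assign ?_).mono (by simp [Term.cost]) fun _ h => h
    refine ⟨?_, fun j hj => ?_⟩
    · simpa [Cmd.exec, Term.eval, hτ.val] using hτ.rep.setVar x (e.eval n m.2 m.1)
    · rw [setReg_reg, if_neg (by omega), hτ.below j hj]
  | tab b a x e =>
    obtain ⟨p, hp⟩ := e.halts_code
    refine ⟨2 + (2 + ((boundPoly b + 1) * (4 + (p + 7)) + (2 +
      ((boundPoly b + 1) * (4 + 8) + 2)))), fun n m d σ h => ?_⟩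
    obtain ⟨ρ, A⟩ := m
    simp only at h
    set f : ℕ → ℕ := fun i => e.eval n A (Function.update ρ x i) with hf
    -- Tabulation takes two passes, `I` for filling the auxiliary array `3` and `J` for copying it.
    -- The expression may therefore read the old contents of the table that is being overwritten.
    let I : ℕ → State → Prop := fun k τ => Rep n (Function.update ρ x k) A τ ∧
      SameBelow d σ τ ∧ τ.reg (2 * d + 3) = ρ x ∧ ∀ i < k, τ.arr 3 i = f i
    let J : ℕ → State → Prop := fun k τ => Rep n (Function.update ρ x k)
        (Function.update A a fun i => if i < k then f i else A a i) τ ∧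
      SameBelow d σ τ ∧ τ.reg (2 * d + 3) = ρ x ∧ ∀ i < bound n b, τ.arr 3 i = f i
    have hI0 : I 0 ((σ.setReg (2 * d + 3) (ρ x)).setReg (2 * x + 2) 0) := by
      refine ⟨(h.setAcc _ _).setVar _ _, fun j hj => ?_, ?_, by simp⟩
      · rw [setReg_reg, if_neg (by omega), setReg_reg, if_neg (by omega)]
      · rw [setReg_reg, if_neg (by omega), setReg_reg, if_pos rfl]
    have hloopI : ∀ τ, I 0 τ → Halts (.loop (.sub (.reg (boundReg b)) (.reg (2 * x + 2))) <|
        .seq (e.code (d + 1)) <|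
        .seq (.store 3 (.reg (2 * x + 2)) (.reg (2 * (d + 1) + 3))) <|
        .assign (2 * x + 2) (.add (.reg (2 * x + 2)) (.lit 1))) τ
        ((bound n b + 1) * (3 + 1 + (p.eval n + 7))) (I (bound n b)) := by
      intro τ hτ
      refine Halts.loop ?_ ?_ hτ
      · rintro k hk τ ⟨hrep, hbel, hsave, haux⟩
        refine ⟨?_, ?_⟩
        · simp only [Term.eval, hrep.bound, hrep.var, Function.update_self]
          omega
        refine (hp n _ A (d + 1) τ hrep).seq fun υ hυ => ?_
        refine (Halts.seq (Halts.store (Q := fun ω => Rep n (Function.update ρ x k) A ω ∧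
          SameBelow d σ ω ∧ ω.reg (2 * d + 3) = ρ x ∧ ∀ i < k + 1, ω.arr 3 i = f i) ?_)
          (s' := 4) ?_).mono (by simp [Term.cost]) fun _ h => h
        · refine ⟨hυ.rep.setAux _ _, fun j hj => ?_, ?_, fun i hi => ?_⟩
          · rw [setArr_reg, hυ.below j (by omega), hbel j hj]
          · rw [setArr_reg, hυ.below _ (by omega), hsave]
          · rw [setArr_arr, if_pos rfl, Function.update_apply]
            simp only [Term.eval, hυ.rep.var, Function.update_self, hυ.val]
            split_ifs with hik
            · rw [hik]
            · rw [hυ.arr, haux i (by omega)]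
        · rintro ω ⟨hrep', hbel', hsave', haux'⟩
          refine (Halts.assign ?_).mono (by simp [Term.cost]) fun _ h => h
          have hv : (Term.add (.reg (2 * x + 2)) (.lit 1)).eval ω = k + 1 := by
            simp [Term.eval, hrep'.var]
          rw [hv]
          refine ⟨?_, fun j hj => ?_, ?_, haux'⟩
          · simpa using hrep'.setVar x (k + 1)
          · rw [setReg_reg, if_neg (by omega), hbel' j hj]
          · rw [setReg_reg, if_neg (by omega), hsave']
      · rintro τ ⟨hrep, -⟩
        simp [Term.eval, hrep.bound, hrep.var]
    have hloopJ : ∀ τ, J 0 τ → Halts (.loop (.sub (.reg (boundReg b)) (.reg (2 * x + 2))) <|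
        .seq (.store (slot a) (.reg (2 * x + 2)) (.get 3 (.reg (2 * x + 2)))) <|
        .assign (2 * x + 2) (.add (.reg (2 * x + 2)) (.lit 1))) τ
        ((bound n b + 1) * (3 + 1 + 8)) (J (bound n b)) := by
      intro τ hτ
      refine Halts.loop ?_ ?_ hτ
      · rintro k hk τ ⟨hrep, hbel, hsave, haux⟩
        refine ⟨?_, ?_⟩
        · simp only [Term.eval, hrep.bound, hrep.var, Function.update_self]
          omega
        refine (Halts.seq (Halts.store (Q := fun ω => Rep n (Function.update ρ x k)
          (Function.update A a fun i => if i < k + 1 then f i else A a i) ω ∧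
          SameBelow d σ ω ∧ ω.reg (2 * d + 3) = ρ x ∧ ∀ i < bound n b, ω.arr 3 i = f i) ?_)
          (s' := 4) ?_).mono (by simp [Term.cost]) fun _ h => h
        · refine ⟨?_, hbel, hsave, fun i hi => ?_⟩
          · have hv : (Term.reg (2 * x + 2)).eval τ = k := by simp [Term.eval, hrep.var]
            have hw : (Term.get 3 (.reg (2 * x + 2))).eval τ = f k := by
              simp [Term.eval, hrep.var, haux k hk]
            rw [hv, hw]
            convert hrep.setArr a k (f k) using 1
            rw [Function.update_idem, Function.update_self]
            congr 1
            funext i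
            rw [Function.update_apply]
            split_ifs <;> first | omega | rfl | (congr 1)
          · rw [setArr_arr, if_neg (slot_ne_three a).symm, haux i hi]
        · rintro ω ⟨hrep', hbel', hsave', haux'⟩
          refine (Halts.assign ?_).mono (by simp [Term.cost]) fun _ h => h
          have hv : (Term.add (.reg (2 * x + 2)) (.lit 1)).eval ω = k + 1 := by
            simp [Term.eval, hrep'.var]
          rw [hv]
          refine ⟨?_, fun j hj => ?_, ?_, haux'⟩
          · simpa using hrep'.setVar x (k + 1)
          · rw [setReg_reg, if_neg (by omega), hbel' j hj]
          · rw [setReg_reg, if_neg (by omega), hsave']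
      · rintro τ ⟨hrep, -⟩
        simp [Term.eval, hrep.bound, hrep.var]
    refine ((Halts.assign (Q := fun τ => τ = σ.setReg (2 * d + 3) (ρ x)) ?_).seq
      fun τ hτ => ((Halts.assign (Q := I 0) ?_).seq fun τ hτ => (hloopI τ hτ).seq fun τ hτ =>
        (Halts.assign (Q := J 0) ?_).seq fun τ hτ => (hloopJ τ hτ).seq fun τ hτ =>
        Halts.assign ?_)).mono
      (by simp [Term.cost]) fun _ h => h
    · simp [Term.eval, h.var]
    · simpa [hτ, Term.eval] using hI0
    · obtain ⟨hrep, hbel, hsave, haux⟩ := hτ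
      refine ⟨?_, fun j hj => ?_, ?_, haux⟩
      · simpa [Term.eval] using hrep.setVar x 0
      · rw [setReg_reg, if_neg (by omega), hbel j hj]
      · rw [setReg_reg, if_neg (by omega), hsave]
    · obtain ⟨hrep, hbel, hsave, -⟩ := hτ
      refine ⟨?_, fun j hj => ?_⟩
      · simpa [Term.eval, hsave, Cmd.exec] using hrep.setVar x (ρ x)
      · rw [setReg_reg, if_neg (by omega), hbel j hj]
  | seq c c' ihc ihd =>
    obtain ⟨p, hp⟩ := ihc
    obtain ⟨q, hq⟩ := ihd
    refine ⟨p + q, fun n m d σ h => ?_⟩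
    refine ((hp n m d σ h).seq (s' := q.eval n) fun τ hτ => ?_).mono (by simp) fun _ h => h
    exact (hq n _ d τ hτ.1).mono le_rfl fun υ hυ =>
      ⟨hυ.1, fun j hj => by rw [hυ.2 j hj, hτ.2 j hj]⟩
  | rep c ih =>
    obtain ⟨p, hp⟩ := ih
    refine ⟨2 + (.X + 1) * (2 + (p + 4)), fun n m d σ h => ?_⟩
    -- The countdown sits in the accumulator `d`, which the body, at depth `d + 1`, preserves.
    let I : ℕ → State → Prop := fun k τ => Rep n ((c.exec n)^[k] m).1 ((c.exec n)^[k] m).2 τ ∧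
      SameBelow d σ τ ∧ τ.reg (2 * d + 3) = n - k
    refine ((Halts.assign (Q := I 0) ?_).seq fun τ hτ => (Halts.loop (I := I) (B := n)
      (s := p.eval n + 4) ?_ ?_ hτ)).mono (by simp [Term.cost]) fun τ hτ => ⟨hτ.1, hτ.2.1⟩
    · refine ⟨h.setAcc _ _, fun j hj => ?_, ?_⟩
      · rw [setReg_reg, if_neg (by omega)]
      · have := h.bound false
        simpa [setReg_reg, Term.eval, boundReg, bound] using this
    · rintro k hk τ ⟨hrep, hbel, hcnt⟩
      refine ⟨?_, ?_⟩
      · simp only [Term.eval, hcnt]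
        omega
      refine (hp n _ (d + 1) τ hrep).seq fun υ hυ => ?_
      refine (Halts.assign ?_).mono (by simp [Term.cost]) fun _ h => h
      refine ⟨?_, fun j hj => ?_, ?_⟩
      · rw [Function.iterate_succ_apply']
        exact hυ.1.setAcc _ _
      · rw [setReg_reg, if_neg (by omega), hυ.2 j (by omega), hbel j hj]
      · simp only [setReg_reg, if_true, Term.eval, hυ.2 d (by omega), hcnt]
        omega
    · rintro τ ⟨-, -, hcnt⟩
      simp [Term.eval, hcnt]

/-- Every command can be executed in polynomial time from a memory with `n` in the register `0`. -/
theorem Cmd.exists_program (c : Cmd) : ∃ (P : Program) (p : Polynomial ℕ),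
    ∀ (n : ℕ) (A : ℕ → ℕ → ℕ) (σ : State), (∀ x, σ.reg x = if x = 0 then n else 0) →
      (∀ a, σ.arr (slot a) = A a) →
      Halts P σ (p.eval n) fun τ => ∀ a, τ.arr (slot a) = (c.exec n (fun _ => 0, A)).2 a := by
  obtain ⟨p, hp⟩ := c.halts_code
  refine ⟨.seq (.assign 2 (.reg 0)) (.seq (.loop (.reg 2)
    (.seq (.assign 1 (.add (.reg 1) (.reg 0))) (.assign 2 (.sub (.reg 2) (.lit 1)))))
    (c.code 0)), 2 + ((.X + 1) * (2 + 8) + p), fun n A σ hreg harr => ?_⟩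
  -- Without multiplication, `n * n` is built by `n` additions. The register `2`, used as countdown,
  -- ends at `0`, as the initial value of the variable it stands for requires.
  let I : ℕ → State → Prop := fun k τ => τ.arr = σ.arr ∧
    ∀ x, τ.reg x = if x = 0 then n else if x = 1 then k * n else if x = 2 then n - k else 0
  refine ((Halts.assign (Q := I 0) ?_).seq fun τ hτ => (Halts.loop (I := I) (B := n)
    (s := 8) ?_ ?_ hτ).seq (s' := p.eval n) fun τ hτ =>
    (hp n (fun _ => 0, A) 0 τ ?_).mono le_rfl fun τ hτ => hτ.1.arr).mono
    (by simp [Term.cost]) fun τ hτ => hτ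
  · refine ⟨rfl, fun x => ?_⟩
    simp only [setReg_reg, Term.eval, hreg]
    split_ifs <;> simp_all
  · rintro k hk τ ⟨ha, hr⟩
    refine ⟨?_, ?_⟩
    · simp only [Term.eval, hr]
      simp
      omega
    refine ((Halts.assign (Q := fun υ => υ = τ.setReg 1 (k * n + n)) ?_).seq fun υ hυ =>
      (Halts.assign ?_)).mono (by simp [Term.cost]) fun _ h => h
    · simp [Term.eval, hr]
    · subst hυ
      refine ⟨ha, fun x => ?_⟩
      simp only [setReg_reg, Term.eval, hr]
      rcases x with _ | _ | _ | x
      · simp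
      · simp; ring
      · simp; omega
      · simp
  · rintro τ ⟨-, hr⟩
    simp [Term.eval, hr]
  · refine ⟨?_, fun x => ?_, fun a => ?_⟩
    · rintro (_ | _) <;> simp [boundReg, bound, hτ.2]
    · rw [hτ.2]
      rcases x with _ | x <;> simp
    · rw [hτ.1, harr]

end RAM

/-! ### Greedy growth of a connected cover

An abstract version of the greedy algorithm: a connected set of links is extended repeatedly by a
link that hits as many new elements as possible and is joined to it by at most three others. -/

namespace Greedy

open Finset
open scoped Classical

variable {ι V : Type*}

/-- Some member of `C` hits `v`. -/
def Covered (hits : ι → V → Prop) (C : Finset ι) (v : V) : Prop := ∃ i ∈ C, hits i v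

/-- The links that can be reached from `C` in `k` steps. -/
def Level (link : ι → Prop) (adj : ι → ι → Prop) (C : Finset ι) : ℕ → ι → Prop
  | 0, i => i ∈ C
  | k + 1, i => link i ∧ ∃ j, Level link adj C k j ∧ adj j i

section

variable {link : ι → Prop} {adj : ι → ι → Prop} {hits : ι → V → Prop}

theorem Covered.mono {C C' : Finset ι} (h : C ⊆ C') {v : V} (hv : Covered hits C v) :
    Covered hits C' v := by
  obtain ⟨i, hi, hiv⟩ := hv
  exact ⟨i, h hi, hiv⟩

theorem Level.isLink {C : Finset ι} {k : ℕ} {i : ι} (h : Level link adj C (k + 1) i) : link i := h.1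

/-- The assumptions on the links and on a solution `O`. -/
structure Cover (link : ι → Prop) (adj : ι → ι → Prop) (hits : ι → V → Prop) (O : Finset ι) :
    Prop where
  refl : ∀ i, link i → adj i i
  close : ∀ i j v, link i → link j → hits i v → hits j v →
    ∃ m m', link m ∧ link m' ∧ adj i m ∧ adj m m' ∧ adj m' j
  hits_some : ∀ i, link i → ∃ v, hits i v
  link : ∀ o ∈ O, link o
  cover : ∀ v, ∃ o ∈ O, hits o v
  connected : ∀ A ⊆ O, A.Nonempty → (∀ a ∈ A, ∀ b ∈ O, adj a b → b ∈ A) → A = O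

variable {C O : Finset ι}

/-- The two links supplied by `close` lead from a member of `C` to `o`. -/
theorem Cover.level_three (h : Cover link adj hits O) (hC : ∀ i ∈ C, link i) {o : ι} (ho : link o)
    (ht : ∃ v, hits o v ∧ Covered hits C v) : Level link adj C 3 o := by
  obtain ⟨v, hov, c, hc, hcv⟩ := ht
  obtain ⟨m, m', hm, hm', h1, h2, h3⟩ := h.close c o v (hC c hc) ho hcv hov
  exact ⟨ho, m', ⟨hm', m, ⟨hm, c, hc, h1⟩, h2⟩, h3⟩

end

/-! ### The greedy step and its potential -/

variable [Fintype V]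

/-- The elements hit by `i` that are not covered by `C`. -/
noncomputable def fresh (hits : ι → V → Prop) (C : Finset ι) (i : ι) : Finset V :=
  univ.filter fun v => ¬ Covered hits C v ∧ hits i v

/-- One step of the greedy algorithm. -/
def Step (link : ι → Prop) (adj : ι → ι → Prop) (hits : ι → V → Prop) (C C' : Finset ι) : Prop :=
  (C' = C ∧ ∀ i, Level link adj C 4 i → (fresh hits C i).card = 0) ∨
  ∃ m₁ m₂ m₃ o, (Level link adj C 1 m₁ ∧ Level link adj C 2 m₂ ∧ Level link adj C 3 m₃ ∧
    Level link adj C 4 o ∧ adj m₁ m₂ ∧ adj m₂ m₃ ∧ adj m₃ o) ∧ 0 < (fresh hits C o).card ∧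
    (∀ i, Level link adj C 4 i → (fresh hits C i).card ≤ (fresh hits C o).card) ∧
    C' = C ∪ {m₁, m₂, m₃, o}

/-- Each term of the harmonic sum between `u'` and `u` is at least `1 / g`, and there are at least
`r` of them. -/
theorem harmonic_add_div_le {u' u r g : ℕ} (h : u' + r ≤ u) (hg : u ≤ g) :
    harmonic u' + (r : ℚ) / g ≤ harmonic u := by
  obtain ⟨s, rfl⟩ := Nat.exists_eq_add_of_le h
  have key : ∀ k, u' + k ≤ g → harmonic u' + (k : ℚ) / g ≤ harmonic (u' + k) := by
    intro k
    induction k with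
    | zero => simp
    | succ k ih =>
      intro hk
      have := ih (by omega)
      rw [← add_assoc, harmonic_succ]
      have h1 : (1 : ℚ) / g ≤ (((u' + k + 1 : ℕ) : ℚ))⁻¹ := by
        rw [← one_div]
        exact one_div_le_one_div_of_le (by positivity) (by exact_mod_cast hk)
      have h2 : ((k + 1 : ℕ) : ℚ) / g = (k : ℚ) / g + 1 / g := by push_cast; ring
      rw [h2]
      linarith
  have h1 := key (r + s) (by omega)
  have h2 : (r : ℚ) / g ≤ ((r + s : ℕ) : ℚ) / g := by
    gcongr
    omega
  rw [add_assoc]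
  linarith

theorem harmonic_le_harmonic {u' u : ℕ} (h : u' ≤ u) : harmonic u' ≤ harmonic u := by
  simpa using harmonic_add_div_le (r := 0) (by simpa using h) le_rfl

/-- The contribution of the link `o` to the potential of `C`. -/
noncomputable def charge (hits : ι → V → Prop) (C : Finset ι) (o : ι) : ℚ :=
  harmonic (fresh hits C o).card + if ∃ v, hits o v ∧ Covered hits C v then 0 else 1

theorem charge_nonneg (hits : ι → V → Prop) (C : Finset ι) (o : ι) : 0 ≤ charge hits C o := by
  have : (0 : ℚ) ≤ harmonic (fresh hits C o).card := by
    simpa using harmonic_le_harmonic (Nat.zero_le (fresh hits C o).card)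
  unfold charge
  split_ifs <;> linarith

theorem charge_le (hits : ι → V → Prop) (C : Finset ι) (o : ι) :
    charge hits C o ≤ harmonic (Fintype.card V) + 1 := by
  have := harmonic_le_harmonic (card_le_univ (fresh hits C o))
  unfold charge
  split_ifs <;> linarith

variable {link : ι → Prop} {adj : ι → ι → Prop} {hits : ι → V → Prop}

section Cover

variable {C C' O : Finset ι}

/-- Let `A` be the set of touched members of `O`. If `A` is closed under adjacency, it is all of
`O`, and the member that hits `v` is near. Otherwise some untouched member is adjacent to a touched
one, and whatever it hits is new. -/
theorem Cover.exists_gain (h : Cover link adj hits O) (hC : ∀ i ∈ C, link i) (hne : C.Nonempty)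
    {v : V} (hv : ¬ Covered hits C v) : ∃ i, Level link adj C 4 i ∧ 0 < (fresh hits C i).card := by
  let A := O.filter fun o => ∃ v, hits o v ∧ Covered hits C v
  have hA : A.Nonempty := by
    obtain ⟨c, hc⟩ := hne
    obtain ⟨w, hw⟩ := h.hits_some c (hC c hc)
    obtain ⟨o, ho, how⟩ := h.cover w
    exact ⟨o, mem_filter.2 ⟨ho, w, how, c, hc, hw⟩⟩
  by_cases hcl : ∀ a ∈ A, ∀ b ∈ O, adj a b → b ∈ A
  · have hAO := h.connected A (filter_subset _ _) hA hcl
    obtain ⟨o, ho, hov⟩ := h.cover v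
    have hoA : o ∈ A := hAO ▸ ho
    have hlo := h.link o ho
    -- Reflexivity of `adj` lifts the third level into the fourth.
    refine ⟨o, ⟨hlo, o, h.level_three hC hlo (mem_filter.1 hoA).2, h.refl o hlo⟩, ?_⟩
    exact card_pos.2 ⟨v, mem_filter.2 ⟨mem_univ _, hv, hov⟩⟩
  · push Not at hcl
    obtain ⟨a, ha, b, hb, hab, hbA⟩ := hcl
    obtain ⟨haO, hat⟩ := mem_filter.1 ha
    have hlb := h.link b hb
    obtain ⟨w, hw⟩ := h.hits_some b hlb
    refine ⟨b, ⟨hlb, a, h.level_three hC (h.link a haO) hat, hab⟩, ?_⟩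
    refine card_pos.2 ⟨w, mem_filter.2 ⟨mem_univ _, fun hc => hbA ?_, hw⟩⟩
    exact mem_filter.2 ⟨hb, w, hw, hc⟩

/-- The potential of `C`. -/
noncomputable def potential (hits : ι → V → Prop) (O C : Finset ι) : ℚ :=
  ∑ o ∈ O, charge hits C o

/-- Let `r` of the `g` fresh nodes of `o` be hit by `p`. A touched `p` was itself a candidate, so it
has at most `g` fresh nodes and its harmonic number drops by `r / g`. An untouched `p` may have
more, but if `r > 0` it becomes touched, and the summand `1` that it loses pays for `r / g ≤ 1`. -/
theorem Cover.charge_drop (h : Cover link adj hits O) (hC : ∀ i ∈ C, link i) {p o : ι}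
    (hp : p ∈ O) (hmax : ∀ i, Level link adj C 4 i → (fresh hits C i).card ≤ (fresh hits C o).card)
    (hCC' : C ⊆ C') (ho : o ∈ C') :
    charge hits C' p +
      (((fresh hits C o).filter fun v => hits p v).card : ℚ) / (fresh hits C o).card ≤
        charge hits C p := by
  set g := (fresh hits C o).card with hg
  set R := (fresh hits C o).filter fun v => hits p v with hR
  have hRmem : ∀ v ∈ R, ¬ Covered hits C v ∧ hits o v ∧ hits p v := by
    intro v hv
    obtain ⟨h1, h2⟩ := mem_filter.1 hv
    obtain ⟨-, h3, h4⟩ := mem_filter.1 h1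
    exact ⟨h3, h4, h2⟩
  have hsub : (fresh hits C' p).card + R.card ≤ (fresh hits C p).card := by
    rw [← card_union_of_disjoint]
    · refine card_le_card fun v hv => ?_
      rcases mem_union.1 hv with hv | hv
      · obtain ⟨-, h1, h2⟩ := mem_filter.1 hv
        exact mem_filter.2 ⟨mem_univ _, fun hc => h1 (hc.mono hCC'), h2⟩
      · obtain ⟨h1, -, h2⟩ := hRmem v hv
        exact mem_filter.2 ⟨mem_univ _, h1, h2⟩
    · refine disjoint_left.2 fun v hv hvR => ?_
      exact (mem_filter.1 hv).2.1 ⟨o, ho, (hRmem v hvR).2.1⟩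
  have hlp := h.link p hp
  unfold charge
  by_cases ht : ∃ v, hits p v ∧ Covered hits C v
  · have ht' : ∃ v, hits p v ∧ Covered hits C' v := by
      obtain ⟨v, h1, h2⟩ := ht
      exact ⟨v, h1, h2.mono hCC'⟩
    rw [if_pos ht, if_pos ht']
    have hle := hmax p ⟨hlp, p, h.level_three hC hlp ht, h.refl p hlp⟩
    simpa using harmonic_add_div_le hsub hle
  · rw [if_neg ht]
    have hmono := harmonic_le_harmonic (show (fresh hits C' p).card ≤ (fresh hits C p).card by omega)
    rcases R.eq_empty_or_nonempty with hRe | ⟨v, hv⟩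
    · rw [hRe]
      simp only [card_empty, Nat.cast_zero, zero_div, add_zero]
      split_ifs <;> linarith
    · have ht' : ∃ v, hits p v ∧ Covered hits C' v :=
        ⟨v, (hRmem v hv).2.2, o, ho, (hRmem v hv).2.1⟩
      rw [if_pos ht']
      have hRg : (R.card : ℚ) / g ≤ 1 := by
        refine div_le_one_of_le₀ ?_ (by positivity)
        exact_mod_cast card_le_card (filter_subset _ _)
      linarith

/-- Every fresh node of `o` is hit by a member of `O`, so the fractions in `charge_drop` add up to
at least `1`. -/
theorem Cover.potential_drop (h : Cover link adj hits O) (hC : ∀ i ∈ C, link i) {o : ι}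
    (hpos : 0 < (fresh hits C o).card)
    (hmax : ∀ i, Level link adj C 4 i → (fresh hits C i).card ≤ (fresh hits C o).card)
    (hCC' : C ⊆ C') (ho : o ∈ C') : potential hits O C' + 1 ≤ potential hits O C := by
  have hsum := sum_le_sum fun p hp => h.charge_drop hC hp hmax hCC' ho
  rw [sum_add_distrib, ← sum_div, ← Nat.cast_sum] at hsum
  have hcard : (fresh hits C o).card ≤
      ∑ p ∈ O, ((fresh hits C o).filter fun v => hits p v).card := by
    refine (card_le_card fun v hv => ?_).trans card_biUnion_le
    obtain ⟨p, hp, hpv⟩ := h.cover v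
    exact mem_biUnion.2 ⟨p, hp, mem_filter.2 ⟨hv, hpv⟩⟩
  have h1 : (1 : ℚ) ≤ ((∑ p ∈ O, ((fresh hits C o).filter fun v => hits p v).card : ℕ) : ℚ) /
      (fresh hits C o).card := by
    rw [one_le_div (by exact_mod_cast hpos)]
    exact_mod_cast hcard
  unfold potential
  linarith

theorem Step.subset (h : Step link adj hits C C') : C ⊆ C' := by
  rcases h with ⟨rfl, -⟩ | ⟨m₁, m₂, m₃, o, -, -, -, rfl⟩
  · exact subset_rfl
  · exact subset_union_left

theorem Step.isLink (h : Step link adj hits C C') (hC : ∀ i ∈ C, link i) : ∀ i ∈ C', link i := by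
  rcases h with ⟨rfl, -⟩ | ⟨m₁, m₂, m₃, o, ⟨h1, h2, h3, h4, -⟩, -, -, rfl⟩
  · exact hC
  · intro i hi
    simp only [mem_union, mem_insert, mem_singleton] at hi
    rcases hi with hi | rfl | rfl | rfl | rfl
    exacts [hC i hi, h1.isLink, h2.isLink, h3.isLink, h4.isLink]

/-- The factor `4` matches the at most four links added by a step that lowers the potential by `1`.
-/
theorem Cover.step_card (h : Cover link adj hits O) (hC : ∀ i ∈ C, link i)
    (hs : Step link adj hits C C') :
    (C'.card : ℚ) + 4 * potential hits O C' ≤ C.card + 4 * potential hits O C := by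
  have hsub := hs.subset
  rcases hs with ⟨rfl, -⟩ | ⟨m₁, m₂, m₃, o, -, hpos, hmax, rfl⟩
  · exact le_rfl
  · have hdrop := h.potential_drop hC hpos hmax hsub (by simp)
    have hcard : (C ∪ {m₁, m₂, m₃, o}).card ≤ C.card + 4 :=
      (card_union_le _ _).trans (Nat.add_le_add_left card_le_four _)
    have : ((C ∪ {m₁, m₂, m₃, o}).card : ℚ) ≤ C.card + 4 := by exact_mod_cast hcard
    linarith

/-- By `exists_gain` the idle case of `Step` cannot occur while something is uncovered. -/
theorem Cover.step_uncovered (h : Cover link adj hits O) (hC : ∀ i ∈ C, link i)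
    (hne : C.Nonempty) (hs : Step link adj hits C C')
    (hu : 0 < (univ.filter fun v => ¬ Covered hits C v).card) :
    (univ.filter fun v => ¬ Covered hits C' v).card <
      (univ.filter fun v => ¬ Covered hits C v).card := by
  have hsub := hs.subset
  obtain ⟨v, hv⟩ := card_pos.1 hu
  obtain ⟨i, hi, hpos⟩ := h.exists_gain hC hne (mem_filter.1 hv).2
  rcases hs with ⟨rfl, h0⟩ | ⟨m₁, m₂, m₃, o, -, hpos, hmax, rfl⟩
  · have := h0 i hi
    omega
  · obtain ⟨w, hw⟩ := card_pos.1 hpos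
    obtain ⟨-, hw, how⟩ := mem_filter.1 hw
    refine card_lt_card ((ssubset_iff_of_subset fun x hx => ?_).2 ⟨w, ?_, fun hw' => ?_⟩)
    · exact mem_filter.2 ⟨mem_univ _, fun hc => (mem_filter.1 hx).2 (hc.mono hsub)⟩
    · exact mem_filter.2 ⟨mem_univ _, hw⟩
    · exact (mem_filter.1 hw').2 ⟨o, by simp, how⟩

end Cover

/-- After as many steps as there are elements, the greedy algorithm has found a cover, whose size
is within a logarithmic factor of the size of every solution. -/
theorem Cover.greedy {O : Finset ι} (h : Cover link adj hits O) (C : ℕ → Finset ι)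
    (hC : ∀ i ∈ C 0, link i) (hne : (C 0).Nonempty)
    (hs : ∀ k, Step link adj hits (C k) (C (k + 1))) :
    (∀ v, Covered hits (C (Fintype.card V)) v) ∧ ∀ k, ((C k).card : ℚ) ≤
      (C 0).card + 4 * (O.card * (harmonic (Fintype.card V) + 1)) := by
  have hall : ∀ k, (∀ i ∈ C k, link i) ∧ (C k).Nonempty ∧
      ((C k).card : ℚ) + 4 * potential hits O (C k) ≤
        (C 0).card + 4 * potential hits O (C 0) ∧
      (univ.filter fun v => ¬ Covered hits (C k) v).card ≤ Fintype.card V - k := by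
    intro k
    induction k with
    | zero => exact ⟨hC, hne, le_rfl, card_le_univ _⟩
    | succ k ih =>
      obtain ⟨h1, h2, h3, h4⟩ := ih
      refine ⟨(hs k).isLink h1, h2.mono (hs k).subset, (h.step_card h1 (hs k)).trans h3, ?_⟩
      rcases Nat.eq_zero_or_pos (univ.filter fun v => ¬ Covered hits (C k) v).card with h0 | h0
      · have : (univ.filter fun v => ¬ Covered hits (C (k + 1)) v).card ≤
            (univ.filter fun v => ¬ Covered hits (C k) v).card :=
          card_le_card fun x hx => mem_filter.2 ⟨mem_univ _, fun hc =>
            (mem_filter.1 hx).2 (hc.mono (hs k).subset)⟩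
        omega
      · have := h.step_uncovered h1 h2 (hs k) h0
        omega
  refine ⟨fun v => ?_, fun k => ?_⟩
  · have h4 := (hall (Fintype.card V)).2.2.2
    rw [Nat.sub_self, Nat.le_zero, card_eq_zero] at h4
    by_contra hv
    have : v ∈ univ.filter fun v => ¬ Covered hits (C (Fintype.card V)) v :=
      mem_filter.2 ⟨mem_univ _, hv⟩
    rw [h4] at this
    simp at this
  · have h3 := (hall k).2.2.1
    have hp : 0 ≤ potential hits O (C k) := sum_nonneg fun o _ => charge_nonneg _ _ _
    have hp0 : potential hits O (C 0) ≤ O.card * (harmonic (Fintype.card V) + 1) := by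
      have := sum_le_sum fun o (_ : o ∈ O) => charge_le hits (C 0) o
      rwa [sum_const, nsmul_eq_mul] at this
    linarith

end Greedy

/-! ### Paths of a tree and covered forests -/

namespace DomSubtree

open SimpleGraph
open scoped Classical

variable {V : Type*} {G T : SimpleGraph V}

/-- The node `w` lies on a shortest path from `a` to `b`. -/
def OnPath (T : SimpleGraph V) (a b w : V) : Prop := T.dist a w + T.dist w b = T.dist a b

theorem onPath_left (T : SimpleGraph V) (a b : V) : OnPath T a b a := by simp [OnPath]

theorem onPath_right (T : SimpleGraph V) (a b : V) : OnPath T a b b := by simp [OnPath]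

theorem isPath_unique (hT : T.IsTree) {a b : V} {p q : T.Walk a b} (hp : p.IsPath)
    (hq : q.IsPath) : p = q := (hT.existsUnique_path a b).unique hp hq

theorem length_eq_dist (hT : T.IsTree) {a b : V} {p : T.Walk a b} (hp : p.IsPath) :
    p.length = T.dist a b := by
  obtain ⟨q, hq, hl⟩ := hT.connected.exists_path_of_dist a b
  rw [isPath_unique hT hp hq, hl]

/-- Two shortest walks of total length `T.dist a b` concatenate to a path, and a tree has only one.
Membership in a tree path thus becomes arithmetic on a distance table. -/
theorem onPath_iff (hT : T.IsTree) {a b w : V} {p : T.Walk a b} (hp : p.IsPath) :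
    OnPath T a b w ↔ w ∈ p.support := by
  constructor
  · intro h
    obtain ⟨q, hq⟩ := hT.connected.exists_walk_length_eq_dist a w
    obtain ⟨r, hr⟩ := hT.connected.exists_walk_length_eq_dist w b
    have hl : (q.append r).length = T.dist a b := by rw [Walk.length_append, hq, hr, h]
    rw [isPath_unique hT hp ((q.append r).isPath_of_length_eq_dist hl)]
    simp
  · intro h
    have h1 := length_eq_dist hT (hp.takeUntil h)
    have h2 := length_eq_dist hT (hp.dropUntil h)
    rw [OnPath, ← h1, ← h2, ← Walk.length_append, Walk.take_spec, length_eq_dist hT hp]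

/-- If the path from `a` to `c` avoids `x`, then `x` can be put in front of it. So of two adjacent
nodes one is the parent of the other. -/
theorem onPath_adj_cases (hT : T.IsTree) {a x : V} (h : T.Adj a x) (c : V) :
    OnPath T a c x ∨ OnPath T x c a := by
  obtain ⟨p, hp⟩ := hT.connected.exists_isPath a c
  by_cases hx : x ∈ p.support
  · exact .inl ((onPath_iff hT hp).2 hx)
  · have : (Walk.cons h.symm p).IsPath := hp.cons hx
    exact .inr ((onPath_iff hT this).2 (by simp))

theorem covers_iff (hT : T.IsTree) {a b : V} {p : T.Walk a b} (hp : p.IsPath) {e : Sym2 V} :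
    Covers T s(a, b) e ↔ e ∈ p.edges := by
  constructor
  · rintro ⟨u, v, q, hf, hq, he⟩
    rcases Sym2.eq_iff.1 hf with ⟨rfl, rfl⟩ | ⟨rfl, rfl⟩
    · rwa [isPath_unique hT hp hq]
    · rw [isPath_unique hT hp hq.reverse]
      simpa using he
  · exact fun he => ⟨a, b, p, rfl, hp, he⟩

/-- For `a = b` this would fail: a trivial path has a node but covers no edge. -/
theorem coveredForest_singleton (hT : T.IsTree) {a b : V} (hab : a ≠ b) {p : T.Walk a b}
    (hp : p.IsPath) : coveredForest T {s(a, b)} = p.toSubgraph := by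
  have hadj : ∀ v w, (coveredForest T {s(a, b)}).Adj v w ↔ p.toSubgraph.Adj v w := by
    intro v w
    simp only [coveredForest, Finset.mem_singleton, exists_eq_left, covers_iff hT hp]
    rw [Walk.adj_toSubgraph_iff_mem_edges]
  have hnil : ¬ p.Nil := fun h => hab h.eq
  refine Subgraph.ext ?_ (by ext v w; exact hadj v w)
  ext v
  rw [Walk.mem_verts_toSubgraph, Walk.mem_support_iff_exists_mem_edges_of_not_nil hnil]
  simp only [coveredForest, Finset.mem_singleton, exists_eq_left, covers_iff hT hp,
    Set.mem_ofPred_eq]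
  constructor
  · rintro ⟨w, hw⟩
    exact ⟨_, hw, by simp⟩
  · rintro ⟨e, he, hv⟩
    obtain ⟨w, rfl⟩ := Sym2.mem_iff_exists.1 hv
    exact ⟨w, he⟩

theorem coveredForest_insert (T : SimpleGraph V) (f : Sym2 V) (F : Finset (Sym2 V)) :
    coveredForest T (insert f F) = coveredForest T F ⊔ coveredForest T {f} := by
  refine Subgraph.ext ?_ ?_
  · ext v
    simp only [coveredForest, Finset.mem_insert, Set.mem_ofPred_eq, Subgraph.verts_sup,
      Set.mem_union, Finset.mem_singleton, exists_eq_left, exists_eq_or_imp]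
    rw [← exists_or]
    exact exists_congr fun _ => or_comm
  · ext v w
    simp only [coveredForest, Finset.mem_insert, Subgraph.sup_adj, Finset.mem_singleton,
      exists_eq_left, exists_eq_or_imp]
    exact or_comm

theorem mem_verts_iff {F : Finset (Sym2 V)} {v : V} :
    v ∈ (coveredForest T F).verts ↔ ∃ f ∈ F, v ∈ (coveredForest T {f}).verts := by
  simp only [coveredForest, Set.mem_ofPred_eq, Finset.mem_singleton, exists_eq_left]
  constructor
  · rintro ⟨w, f, hf, h⟩
    exact ⟨f, hf, w, h⟩
  · rintro ⟨f, hf, w, h⟩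
    exact ⟨w, f, hf, h⟩

theorem mem_verts_singleton (hT : T.IsTree) {a b v : V} (hab : a ≠ b) :
    v ∈ (coveredForest T {s(a, b)}).verts ↔ OnPath T a b v := by
  obtain ⟨p, hp⟩ := hT.connected.exists_isPath a b
  rw [coveredForest_singleton hT hab hp, Walk.mem_verts_toSubgraph, onPath_iff hT hp]

theorem connected_singleton (hT : T.IsTree) {a b : V} (hab : a ≠ b) :
    (coveredForest T {s(a, b)}).Connected := by
  obtain ⟨p, hp⟩ := hT.connected.exists_isPath a b
  rw [coveredForest_singleton hT hab hp]
  exact p.toSubgraph_connected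

theorem connected_insert (hT : T.IsTree) {F : Finset (Sym2 V)}
    (hF : (coveredForest T F).Connected) {a b v : V} (hab : a ≠ b)
    (hv : v ∈ (coveredForest T F).verts) (hv' : OnPath T a b v) :
    (coveredForest T (insert s(a, b) F)).Connected := by
  rw [coveredForest_insert]
  exact Subgraph.connected_sup hF.preconnected (connected_singleton hT hab).preconnected
    ⟨v, hv, (mem_verts_singleton hT hab).2 hv'⟩

/-- A connected subgraph of a tree contains the paths between its nodes. -/
theorem onPath_mem_verts (hT : T.IsTree) {H : T.Subgraph} (hH : H.Connected) {x y w : V}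
    (hx : x ∈ H.verts) (hy : y ∈ H.verts) (hw : OnPath T x y w) : w ∈ H.verts := by
  obtain ⟨p⟩ := hH.preconnected ⟨x, hx⟩ ⟨y, hy⟩
  have hp := (p.map H.hom).bypass_isPath
  have h := (p.map H.hom).support_bypass_subset_support ((onPath_iff hT hp).1 hw)
  rw [Walk.support_map, List.mem_map] at h
  obtain ⟨z, -, rfl⟩ := h
  exact z.2

/-- In a connected covered forest, all covering edges are linked by common nodes. -/
theorem eq_of_closed {F A : Finset (Sym2 V)} (hF : (coveredForest T F).Connected)
    (hne : ∀ f ∈ F, (coveredForest T {f}).verts.Nonempty) (hA : A ⊆ F) (hAne : A.Nonempty)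
    (hcl : ∀ a ∈ A, ∀ b ∈ F, ∀ w ∈ (coveredForest T {a}).verts, w ∈ (coveredForest T {b}).verts →
      b ∈ A) : A = F := by
  refine hA.antisymm fun b hb => ?_
  obtain ⟨a, ha⟩ := hAne
  obtain ⟨x, hx⟩ := hne a (hA ha)
  obtain ⟨y, hy⟩ := hne b hb
  have hxF : x ∈ (coveredForest T F).verts := mem_verts_iff.2 ⟨a, hA ha, hx⟩
  have hyF : y ∈ (coveredForest T F).verts := mem_verts_iff.2 ⟨b, hb, hy⟩
  obtain ⟨p⟩ := hF.preconnected ⟨x, hxF⟩ ⟨y, hyF⟩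
  have key : ∀ (u v : (coveredForest T F).verts), (coveredForest T F).coe.Walk u v →
      (∃ a ∈ A, u.1 ∈ (coveredForest T {a}).verts) →
      ∃ a ∈ A, v.1 ∈ (coveredForest T {a}).verts := by
    intro u v p
    induction p with
    | nil => exact id
    | @cons u z v h p ih =>
      rintro ⟨a, ha, hu⟩
      obtain ⟨f, hf, hfe⟩ := h
      have h1 : u.1 ∈ (coveredForest T {f}).verts := ⟨z.1, f, by simp, hfe⟩
      have h2 : z.1 ∈ (coveredForest T {f}).verts := ⟨u.1, f, by simp, by rwa [Sym2.eq_swap]⟩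
      exact ih ⟨f, hcl a ha f hf _ hu h1, h2⟩
  obtain ⟨a', ha', hya⟩ := key _ _ p ⟨a, ha, hx⟩
  exact hcl a' ha' b hb y hya hy

/-! ### The cover problem behind the Dominating Subtree problem -/

/-- The ordered pair `q` is an edge of `G` outside `T`. -/
def Link (G T : SimpleGraph V) (q : V × V) : Prop := G.Adj q.1 q.2 ∧ ¬ T.Adj q.1 q.2

/-- The tree paths between the two pairs share a node. -/
def Meets (T : SimpleGraph V) (q q' : V × V) : Prop :=
  ∃ w, OnPath T q.1 q.2 w ∧ OnPath T q'.1 q'.2 w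

/-- The path of the link `q`, possibly joined to one further link at `v`, contains the parent
of `v`. -/
def Hits (G T : SimpleGraph V) (par : V → V) (q : V × V) (v : V) : Prop :=
  OnPath T q.1 q.2 (par v) ∨
    ∃ u, OnPath T q.1 q.2 u ∧ Link G T (u, v) ∧ OnPath T u v (par v)

/-- `par` maps every node to the next one on its path to the root `c`. -/
def IsParent (T : SimpleGraph V) (c : V) (par : V → V) : Prop :=
  ∀ v, v = c ∧ par v = v ∨ T.Adj v (par v) ∧ OnPath T v c (par v)

/-- The unordered pairs in a set of ordered pairs. -/
noncomputable def edges (C : Finset (V × V)) : Finset (Sym2 V) := C.image fun q => s(q.1, q.2)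

theorem edges_singleton (q : V × V) : edges {q} = {s(q.1, q.2)} := Finset.image_singleton _ _

theorem card_edges_le (C : Finset (V × V)) : (edges C).card ≤ C.card := Finset.card_image_le

theorem Link.ne {q : V × V} (h : Link G T q) : q.1 ≠ q.2 := h.1.ne

theorem mem_verts_edges (hT : T.IsTree) {C : Finset (V × V)} (hC : ∀ q ∈ C, Link G T q) {v : V} :
    v ∈ (coveredForest T (edges C)).verts ↔ ∃ q ∈ C, OnPath T q.1 q.2 v := by
  rw [mem_verts_iff]
  simp only [edges, Finset.mem_image, exists_exists_and_eq_and]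
  exact exists_congr fun q => and_congr_right fun hq => mem_verts_singleton hT (hC q hq).ne

/-- The path to the root has only one second node. At `v = c` the premise is contradictory, since
the path is trivial. -/
theorem IsParent.eq (hT : T.IsTree) {c : V} {par : V → V} (h : IsParent T c par) {v u : V}
    (hvu : T.Adj v u) (hu : OnPath T v c u) : par v = u := by
  obtain ⟨p, hp⟩ := hT.connected.exists_isPath v c
  have hu' := hT.isAcyclic.eq_snd_of_adj_start hp hvu ((onPath_iff hT hp).1 hu)
  rcases h v with ⟨rfl, -⟩ | ⟨h1, h2⟩
  · have hd : T.dist v u = 1 := dist_eq_one_iff_adj.2 hvu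
    simp [OnPath, hd] at hu
  · rw [hu', hT.isAcyclic.eq_snd_of_adj_start hp h1 ((onPath_iff hT hp).1 h2)]

theorem IsParent.mem_verts (hT : T.IsTree) {c : V} {par : V → V} (h : IsParent T c par)
    {H : T.Subgraph} (hH : H.Connected) (hc : c ∈ H.verts) {v : V} (hv : v ∈ H.verts) :
    par v ∈ H.verts := by
  rcases h v with ⟨-, h1⟩ | ⟨-, h2⟩
  · rwa [h1]
  · exact onPath_mem_verts hT hH hv hc h2

theorem Hits.exists_link {par : V → V} {q : V × V} {v : V} (hq : Link G T q)
    (h : Hits G T par q v) : ∃ m, Link G T m ∧ Meets T q m ∧ OnPath T m.1 m.2 (par v) := by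
  rcases h with h | ⟨u, h1, h2, h3⟩
  · exact ⟨q, hq, ⟨q.1, onPath_left _ _ _, onPath_left _ _ _⟩, h⟩
  · exact ⟨(u, v), h2, ⟨u, h1, onPath_left _ _ _⟩, h3⟩

theorem Meets.symm {q q' : V × V} (h : Meets T q q') : Meets T q' q := by
  obtain ⟨w, h1, h2⟩ := h
  exact ⟨w, h2, h1⟩

/-- Each hit supplies a link whose path contains `par v`, and these two links meet there. This is
why `Hits` demands the parent on a path rather than mere domination of `v`. -/
theorem Hits.close {par : V → V} {q q' : V × V} {v : V} (hq : Link G T q) (hq' : Link G T q')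
    (h : Hits G T par q v) (h' : Hits G T par q' v) : ∃ m m', Link G T m ∧ Link G T m' ∧
      Meets T q m ∧ Meets T m m' ∧ Meets T m' q' := by
  obtain ⟨m, h1, h2, h3⟩ := h.exists_link hq
  obtain ⟨m', h1', h2', h3'⟩ := h'.exists_link hq'
  exact ⟨m, m', h1, h1', h2, ⟨_, h3, h3'⟩, h2'.symm⟩

/-- One end of the first edge of the path has the other end as its parent, and is therefore hit. -/
theorem Link.hits_some (hT : T.IsTree) {c : V} {par : V → V} (hpar : IsParent T c par) {q : V × V}
    (hq : Link G T q) : ∃ v, Hits G T par q v := by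
  obtain ⟨p, hp⟩ := hT.connected.exists_isPath q.1 q.2
  have hnil : ¬ p.Nil := fun h => hq.ne h.eq
  have hadj := p.adj_snd hnil
  rcases onPath_adj_cases hT hadj c with h | h
  · refine ⟨q.1, .inl ?_⟩
    rw [hpar.eq hT hadj h, onPath_iff hT hp]
    exact p.getVert_mem_support 1
  · refine ⟨p.snd, .inl ?_⟩
    rw [hpar.eq hT hadj.symm h]
    exact onPath_left _ _ _

/-! ### Feasible solutions and covers -/

/-- A feasible solution that contains the root hits every node. -/
theorem hits_of_feasible (hT : T.IsTree) {c : V} {par : V → V} (hpar : IsParent T c par)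
    {O : Finset (V × V)} (hO : ∀ q ∈ O, Link G T q) (hconn : (coveredForest T (edges O)).Connected)
    (hdom : IsDominating G (coveredForest T (edges O)).verts)
    (hc : c ∈ (coveredForest T (edges O)).verts) (v : V) : ∃ q ∈ O, Hits G T par q v := by
  by_cases hp : par v ∈ (coveredForest T (edges O)).verts
  · obtain ⟨q, hq, h⟩ := (mem_verts_edges hT hO).1 hp
    exact ⟨q, hq, .inl h⟩
  have hv : v ∉ (coveredForest T (edges O)).verts := fun hv => hp (hpar.mem_verts hT hconn hc hv)
  obtain ⟨u, hu, hvu⟩ := hdom v hv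
  -- If `uv` were a tree edge, one end would be the parent of the other, and closure under parents
  -- would put `v` or `par v` into the forest.
  have huv : Link G T (u, v) := by
    refine ⟨hvu.symm, fun hadj => ?_⟩
    replace hadj : T.Adj u v := hadj
    rcases onPath_adj_cases hT hadj c with h | h
    · exact hv (hpar.eq hT hadj h ▸ hpar.mem_verts hT hconn hc hu)
    · exact hp (by rwa [hpar.eq hT hadj.symm h])
  -- With the path of `uv` added, the connected forest contains `c` and `v`, hence also `par v`. The
  -- old forest does not, so `par v` lies on the new path.
  have hconn' := connected_insert hT hconn huv.ne hu (onPath_left _ _ _)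
  have hc' : c ∈ (coveredForest T (insert s(u, v) (edges O))).verts := by
    rw [coveredForest_insert]
    exact .inl hc
  have hv' : v ∈ (coveredForest T (insert s(u, v) (edges O))).verts := by
    rw [coveredForest_insert]
    exact .inr ((mem_verts_singleton hT huv.ne).2 (onPath_right _ _ _))
  have hp' := hpar.mem_verts hT hconn' hc' hv'
  rw [coveredForest_insert] at hp'
  have hp'' := (mem_verts_singleton hT huv.ne).1 (hp'.resolve_left hp)
  obtain ⟨q, hq, h⟩ := (mem_verts_edges hT hO).1 hu
  exact ⟨q, hq, .inr ⟨u, h, huv, hp''⟩⟩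

/-- A feasible solution can be extended by at most one edge to one that contains the neighbor `c` of
a leaf `l`. -/
theorem exists_feasible_root (hT : T.IsTree) {l c : V} (hl : ∀ x, T.Adj l x → x = c)
    {F : Finset (Sym2 V)} (hF : IsFeasible G T F) : ∃ F', IsFeasible G T F' ∧
      F'.card ≤ F.card + 1 ∧ c ∈ (coveredForest T F').verts := by
  -- The only tree edge at the leaf `l` is `lc`.
  have hmem : ∀ F' : Finset (Sym2 V), l ∈ (coveredForest T F').verts →
      c ∈ (coveredForest T F').verts := by
    intro F' h
    obtain ⟨w, hw⟩ := h
    have hadj : (coveredForest T F').Adj l w := hw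
    rw [← hl w hadj.adj_sub]
    exact (coveredForest T F').edge_vert hadj.symm
  by_cases hlF : l ∈ (coveredForest T F).verts
  · exact ⟨F, hF, by omega, hmem F hlF⟩
  obtain ⟨u, hu, hlu⟩ := hF.dominating l hlF
  by_cases hadj : T.Adj l u
  · exact ⟨F, hF, by omega, by rwa [← hl u hadj]⟩
  have hconn : (coveredForest T F).Connected :=
    Subgraph.connected_iff'.2 hF.tree.connected
  -- The link `lu` brings `l`, and with it `c`, into the forest.
  have hconn' := connected_insert hT hconn hlu.ne hu (onPath_right _ _ _)
  refine ⟨insert s(l, u) F, ⟨?_, ⟨?_, hT.isAcyclic.subgraph _⟩, ?_⟩, Finset.card_insert_le _ _,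
    hmem _ ?_⟩
  · rw [Finset.coe_insert]
    exact Set.insert_subset ⟨hlu, hadj⟩ hF.subset
  · exact Subgraph.connected_iff'.1 hconn'
  · intro v hv
    rw [coveredForest_insert] at hv ⊢
    obtain ⟨x, hx, hvx⟩ := hF.dominating v fun h => hv (.inl h)
    exact ⟨x, .inl hx, hvx⟩
  · rw [coveredForest_insert]
    exact .inr ((mem_verts_singleton hT hlu.ne).2 (onPath_left _ _ _))

/-- A feasible solution is a cover in the sense of the greedy algorithm. -/
theorem exists_cover (hT : T.IsTree) {l c : V} (hl : ∀ x, T.Adj l x → x = c) {par : V → V}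
    (hpar : IsParent T c par) {F : Finset (Sym2 V)} (hF : IsFeasible G T F) :
    ∃ O : Finset (V × V), O.card ≤ F.card + 1 ∧ O.Nonempty ∧
      Greedy.Cover (Link G T) (Meets T) (Hits G T par) O := by
  obtain ⟨F', hF', hcard, hc⟩ := exists_feasible_root hT hl hF
  let O : Finset (V × V) := F'.image fun f => f.out
  have hout : ∀ f : Sym2 V, s(f.out.1, f.out.2) = f := fun f => f.out_eq
  have hedges : edges O = F' := by
    ext f
    simp [edges, O, hout]
  have hO : ∀ q ∈ O, Link G T q := by
    intro q hq
    obtain ⟨f, hf, rfl⟩ := Finset.mem_image.1 hq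
    have := hF'.subset hf
    rw [← hout f] at this
    exact this
  have hconn : (coveredForest T (edges O)).Connected := by
    rw [hedges]
    exact Subgraph.connected_iff'.2 hF'.tree.connected
  have hcover : ∀ v, ∃ q ∈ O, Hits G T par q v :=
    hits_of_feasible hT hpar hO hconn (hedges ▸ hF'.dominating) (hedges ▸ hc)
  refine ⟨O, Finset.card_image_le.trans hcard, ?_, ⟨fun q _ => ⟨q.1, onPath_left _ _ _,
    onPath_left _ _ _⟩, fun i j v hi hj h h' => h.close hi hj h', fun q hq => hq.hits_some hT hpar,
    hO, hcover, ?_⟩⟩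
  · obtain ⟨q, hq, -⟩ := hcover c
    exact ⟨q, hq⟩
  · intro A hA hAne hcl
    have hAe : edges A = edges O := by
      refine eq_of_closed hconn ?_ (Finset.image_subset_image hA) (hAne.image _) ?_
      · intro f hf
        obtain ⟨q, hq, rfl⟩ := Finset.mem_image.1 hf
        exact ⟨q.1, (mem_verts_singleton hT (hO q hq).ne).2 (onPath_left _ _ _)⟩
      · intro f hf f' hf' w hw hw'
        obtain ⟨q, hq, rfl⟩ := Finset.mem_image.1 hf
        obtain ⟨q', hq', rfl⟩ := Finset.mem_image.1 hf'
        rw [mem_verts_singleton hT (hO q (hA hq)).ne] at hw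
        rw [mem_verts_singleton hT (hO q' hq').ne] at hw'
        exact Finset.mem_image_of_mem _ (hcl q hq q' hq' ⟨w, hw, hw'⟩)
    -- Equality of the unordered edges suffices because `O` contains only the orientation chosen by
    -- `Sym2.out`.
    refine hA.antisymm fun q hq => ?_
    have : s(q.1, q.2) ∈ edges A := hAe ▸ Finset.mem_image_of_mem _ hq
    obtain ⟨q', hq', he⟩ := Finset.mem_image.1 this
    obtain ⟨f, -, rfl⟩ := Finset.mem_image.1 hq
    obtain ⟨f', -, rfl⟩ := Finset.mem_image.1 (hA hq')
    rw [hout, hout] at he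
    rwa [← he]

/-- A step of the greedy algorithm keeps the covered forest connected. -/
theorem connected_step (hT : T.IsTree) {hits : V × V → V → Prop} [Fintype V]
    {C C' : Finset (V × V)} (hC : ∀ q ∈ C, Link G T q)
    (hconn : (coveredForest T (edges C)).Connected)
    (hs : Greedy.Step (Link G T) (Meets T) hits C C') :
    (coveredForest T (edges C')).Connected := by
  have hins : ∀ (D : Finset (V × V)) (q m : V × V), (∀ q ∈ D, Link G T q) →
      (coveredForest T (edges D)).Connected → q ∈ D → Link G T m → Meets T q m →
      (∀ q ∈ insert m D, Link G T q) ∧ (coveredForest T (edges (insert m D))).Connected := by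
    rintro D q m hD hconn hq hm ⟨w, h1, h2⟩
    refine ⟨fun x hx => ?_, ?_⟩
    · rcases Finset.mem_insert.1 hx with rfl | hx
      exacts [hm, hD x hx]
    · rw [edges, Finset.image_insert]
      exact connected_insert hT hconn hm.ne ((mem_verts_edges hT hD).2 ⟨q, hq, h1⟩) h2
  rcases hs with ⟨rfl, -⟩ | ⟨m₁, m₂, m₃, o, ⟨⟨h1, q, hq, hq1⟩, h2, h3, h4, h12, h23, h34⟩, -, -, rfl⟩
  · exact hconn
  -- The links are inserted in the order of the chain, so that each one meets a link already
  -- present.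
  · obtain ⟨a1, b1⟩ := hins C q m₁ hC hconn hq h1 hq1
    obtain ⟨a2, b2⟩ := hins _ m₁ m₂ a1 b1 (by simp) h2.isLink h12
    obtain ⟨a3, b3⟩ := hins _ m₂ m₃ a2 b2 (by simp) h3.isLink h23
    obtain ⟨a4, b4⟩ := hins _ m₃ o a3 b3 (by simp) h4.isLink h34
    convert b4 using 3
    ext x
    simp only [Finset.mem_union, Finset.mem_insert, Finset.mem_singleton]
    tauto

/-- A connected cover is a feasible solution. -/
theorem isFeasible_edges (hT : T.IsTree) (hTG : T ≤ G) {c : V} {par : V → V}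
    (hpar : IsParent T c par) {C : Finset (V × V)} (hC : ∀ q ∈ C, Link G T q)
    (hconn : (coveredForest T (edges C)).Connected)
    (hcov : ∀ v, Greedy.Covered (Hits G T par) C v) : IsFeasible G T (edges C) := by
  refine ⟨fun f hf => ?_, ⟨Subgraph.connected_iff'.1 hconn, hT.isAcyclic.subgraph _⟩,
    fun v hv => ?_⟩
  · obtain ⟨q, hq, rfl⟩ := Finset.mem_image.1 hf
    exact hC q hq
  · obtain ⟨q, hq, h | ⟨u, h1, h2, -⟩⟩ := hcov v
    · have hp := (mem_verts_edges hT hC).2 ⟨q, hq, h⟩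
      -- At the root `par v = v` is in the forest itself; elsewhere the parent is a tree neighbor
      -- and dominates `v`.
      rcases hpar v with ⟨-, h'⟩ | ⟨h', -⟩
      · exact absurd (h' ▸ hp) hv
      · exact ⟨_, hp, hTG h'⟩
    · exact ⟨u, (mem_verts_edges hT hC).2 ⟨q, hq, h1⟩, h2.1.symm⟩

theorem exists_isParent (hT : T.IsTree) (c : V) (v : V) :
    ∃ p, v = c ∧ p = v ∨ T.Adj v p ∧ OnPath T v c p := by
  by_cases h : v = c
  · exact ⟨v, .inl ⟨h, rfl⟩⟩
  · obtain ⟨p, hp⟩ := hT.connected.exists_isPath v c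
    refine ⟨p.snd, .inr ⟨p.adj_snd fun h' => h h'.eq, (onPath_iff hT hp).2 ?_⟩⟩
    exact p.getVert_mem_support 1

end DomSubtree

/-! ### Semantics of bounded programs -/

namespace RAM

open Finset
open scoped Classical

namespace Exp

/-- Negation. -/
def not (e : Exp) : Exp := .sub (.lit 1) e

/-- Conjunction. -/
def and (e f : Exp) : Exp := (Exp.add e.not f.not).not

/-- Comparison. -/
def le (e f : Exp) : Exp := (Exp.sub e f).not

/-- Equality. -/
def eq (e f : Exp) : Exp := (e.le f).and (f.le e)

/-- The expression `e`, read as a condition, is true. -/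
def Holds (n : ℕ) (A : ℕ → ℕ → ℕ) (ρ : ℕ → ℕ) (e : Exp) : Prop := e.eval n A ρ ≠ 0

variable {n : ℕ} {A : ℕ → ℕ → ℕ} {ρ : ℕ → ℕ} {e f : Exp}

theorem holds_not : e.not.Holds n A ρ ↔ ¬ e.Holds n A ρ := by
  simp only [Holds, not, eval]
  omega

theorem holds_add : (Exp.add e f).Holds n A ρ ↔ e.Holds n A ρ ∨ f.Holds n A ρ := by
  simp only [Holds, eval]
  omega

theorem holds_and : (e.and f).Holds n A ρ ↔ e.Holds n A ρ ∧ f.Holds n A ρ := by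
  simp only [and, holds_not, holds_add]
  tauto

theorem holds_le : (e.le f).Holds n A ρ ↔ e.eval n A ρ ≤ f.eval n A ρ := by
  simp only [le, holds_not]
  simp only [Holds, eval]
  omega

theorem holds_eq : (e.eq f).Holds n A ρ ↔ e.eval n A ρ = f.eval n A ρ := by
  simp only [eq, holds_and, holds_le]
  omega

theorem holds_sum {b : Bool} {x : ℕ} : (Exp.sum b x e).Holds n A ρ ↔
    ∃ i < bound n b, e.Holds n A (Function.update ρ x i) := by
  simp [Holds, eval]

theorem holds_get {a : ℕ} : (Exp.get a e).Holds n A ρ ↔ A a (e.eval n A ρ) ≠ 0 := Iff.rfl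

theorem holds_var {x : ℕ} : (Exp.var x).Holds n A ρ ↔ ρ x ≠ 0 := Iff.rfl

theorem eval_not_not : e.not.not.eval n A ρ = if e.Holds n A ρ then 1 else 0 := by
  by_cases h : e.eval n A ρ = 0
  · simp [not, eval, Holds, h]
  · simp only [not, eval, Holds, ne_eq, h, not_false_eq_true, if_true]
    omega

theorem argmax_spec {b : Bool} {x : ℕ} (hb : 0 < bound n b) :
    (Exp.argmax b x e).eval n A ρ < bound n b ∧ ∀ i < bound n b,
      e.eval n A (Function.update ρ x i) ≤
        e.eval n A (Function.update ρ x ((Exp.argmax b x e).eval n A ρ)) := by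
  obtain ⟨h1, h2⟩ := firstMax_spec (fun i => e.eval n A (Function.update ρ x i)) hb
  exact ⟨h1, fun i hi => (le_firstMax _ _ i hi).trans h2.le⟩

end Exp

namespace Cmd

variable {n : ℕ} {m : Mem} {b : Bool} {a x : ℕ} {e : Exp}

theorem exec_tab_self {i : ℕ} (hi : i < bound n b) :
    ((tab b a x e).exec n m).2 a i = e.eval n m.2 (Function.update m.1 x i) := by
  simp [exec, hi]

theorem exec_tab_ne {a' : ℕ} (h : a' ≠ a) : ((tab b a x e).exec n m).2 a' = m.2 a' := by
  simp [exec, h]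

theorem exec_set_self : ((set x e).exec n m).1 x = e.eval n m.2 m.1 := by
  simp [exec]

theorem exec_set_ne {y : ℕ} (h : y ≠ x) : ((set x e).exec n m).1 y = m.1 y := by
  simp [exec, h]

theorem exec_set_arr : ((set x e).exec n m).2 = m.2 := rfl

theorem exec_seq {c d : Cmd} : (seq c d).exec n m = d.exec n (c.exec n m) := rfl

theorem exec_rep {c : Cmd} (P : ℕ → Mem → Prop) (h0 : P 0 m)
    (hs : ∀ k m, P k m → P (k + 1) (c.exec n m)) : P n ((rep c).exec n m) := by
  have : ∀ k, P k ((c.exec n)^[k] m) := by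
    intro k
    induction k with
    | zero => exact h0
    | succ k ih =>
      rw [Function.iterate_succ_apply']
      exact hs k _ ih
  exact this n

end Cmd

/-- The row-major index of a pair. -/
def idx {n : ℕ} (q : Fin n × Fin n) : ℕ := (q.1 : ℕ) * n + q.2

section Index

variable {n : ℕ}

theorem idx_lt (q : Fin n × Fin n) : idx q < bound n true := by
  have h1 : ((q.1 : ℕ) + 1) * n ≤ n * n := Nat.mul_le_mul_right _ q.1.2
  have h2 := q.2.2
  have h3 : ((q.1 : ℕ) + 1) * n = q.1 * n + n := by ring
  simp only [idx, bound]
  omega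

theorem idx_div (q : Fin n × Fin n) : idx q / n = q.1 := by
  have hn : 0 < n := q.1.pos
  rw [idx, mul_comm, Nat.mul_add_div hn, Nat.div_eq_of_lt q.2.2, add_zero]

theorem idx_mod (q : Fin n × Fin n) : idx q % n = q.2 := by
  rw [idx, mul_comm, Nat.mul_add_mod, Nat.mod_eq_of_lt q.2.2]

theorem idx_inj {q q' : Fin n × Fin n} : idx q = idx q' ↔ q = q' := by
  refine ⟨fun h => Prod.ext (Fin.ext ?_) (Fin.ext ?_), fun h => h ▸ rfl⟩
  · rw [← idx_div, h, idx_div]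
  · rw [← idx_mod, h, idx_mod]

theorem exists_idx {i : ℕ} (hi : i < bound n true) : ∃ q : Fin n × Fin n, i = idx q := by
  have hn : 0 < n := Nat.pos_of_ne_zero fun h => by simp [h, bound] at hi
  refine ⟨(⟨i / n, Nat.div_lt_of_lt_mul hi⟩, ⟨i % n, Nat.mod_lt _ hn⟩), ?_⟩
  simp only [idx]
  rw [mul_comm, Nat.div_add_mod]

theorem exists_lt_bound_true {P : ℕ → Prop} :
    (∃ i < bound n true, P i) ↔ ∃ q : Fin n × Fin n, P (idx q) := by
  constructor
  · rintro ⟨i, hi, h⟩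
    obtain ⟨q, rfl⟩ := exists_idx hi
    exact ⟨q, h⟩
  · rintro ⟨q, h⟩
    exact ⟨_, idx_lt q, h⟩

theorem exists_lt_bound_false {P : ℕ → Prop} :
    (∃ i < bound n false, P i) ↔ ∃ v : Fin n, P v := by
  constructor
  · rintro ⟨i, hi, h⟩
    exact ⟨⟨i, hi⟩, h⟩
  · rintro ⟨v, h⟩
    exact ⟨v, v.2, h⟩

variable {A : ℕ → ℕ → ℕ} {ρ : ℕ → ℕ} {e : Exp} {x : ℕ}

theorem argmax_pair (hn : 0 < n) : ∃ q : Fin n × Fin n, (Exp.argmax true x e).eval n A ρ = idx q ∧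
    ∀ q' : Fin n × Fin n,
      e.eval n A (Function.update ρ x (idx q')) ≤ e.eval n A (Function.update ρ x (idx q)) := by
  obtain ⟨h1, h2⟩ := Exp.argmax_spec (e := e) (A := A) (ρ := ρ) (x := x)
    (show 0 < bound n true from Nat.mul_pos hn hn)
  obtain ⟨q, hq⟩ := exists_idx h1
  rw [hq] at h2
  exact ⟨q, hq, fun q' => h2 _ (idx_lt q')⟩

/-- Applied to a condition, `argmax` acts as a choice operator: a maximum is nonzero as soon as some
value is. -/
theorem argmax_pair_holds {P : Fin n × Fin n → Prop}
    (hP : ∀ q, e.Holds n A (Function.update ρ x (idx q)) ↔ P q) (h : ∃ q, P q) :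
    ∃ q, (Exp.argmax true x e).eval n A ρ = idx q ∧ P q := by
  obtain ⟨q', hq'⟩ := h
  obtain ⟨q, hq, hmax⟩ := argmax_pair (A := A) (ρ := ρ) (e := e) (x := x) q'.1.pos
  refine ⟨q, hq, (hP q).1 fun h0 => (hP q').2 hq' ?_⟩
  exact Nat.le_zero.1 ((hmax q').trans h0.le)

theorem argmax_node_holds {P : Fin n → Prop}
    (hP : ∀ v : Fin n, e.Holds n A (Function.update ρ x v) ↔ P v) (h : ∃ v, P v) :
    ∃ v : Fin n, (Exp.argmax false x e).eval n A ρ = v ∧ P v := by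
  obtain ⟨v', hv'⟩ := h
  obtain ⟨h1, h2⟩ := Exp.argmax_spec (e := e) (A := A) (ρ := ρ) (x := x)
    (show 0 < bound n false from v'.pos)
  refine ⟨⟨_, h1⟩, rfl, (hP _).1 fun h0 => (hP v').2 hv' ?_⟩
  exact Nat.le_zero.1 ((h2 v' v'.2).trans h0.le)

/-- A bounded sum of truth values counts nodes. -/
theorem eval_count {P : Fin n → Prop} (hP : ∀ v : Fin n, e.Holds n A (Function.update ρ x v) ↔ P v) :
    (Exp.sum false x e.not.not).eval n A ρ = (univ.filter P).card := by
  simp only [Exp.eval, Exp.eval_not_not, bound]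
  rw [sum_range, card_filter]
  exact sum_congr rfl fun v _ => by simp only [hP]

end Index

end RAM

/-! ### The algorithm -/

namespace DomSubtree

open RAM RAM.Exp Finset SimpleGraph
open scoped Classical

/-- The entry in row `u` and column `v` of the matrix `a`. -/
def matE (a : ℕ) (u v : Exp) : Exp := .get a (.add (.get 5 u) v)

/-- The node `w` lies on the tree path from `a` to `b`. -/
def pathE (a b w : Exp) : Exp := (Exp.add (matE 7 a w) (matE 7 w b)).eq (matE 7 a b)

/-- The node `w` lies on the tree path of the pair `i`. -/
def onE (i w : Exp) : Exp := pathE (.get 3 i) (.get 4 i) w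

/-- The pair `i` is an edge outside the tree. -/
def linkE (i : Exp) : Exp := (Exp.get 0 i).and (Exp.get 1 i).not

/-- The pair `i` hits the node `v`. -/
def hitE (i v : ℕ) : Exp :=
  .add (onE (.var i) (.get 8 (.var v))) <| .sum false 50 <| (onE (.var i) (.var 50)).and <|
    (linkE (.add (.get 5 (.var 50)) (.var v))).and (pathE (.var 50) (.var v) (.get 8 (.var v)))

/-- The paths of the pairs `i` and `j` share a node. -/
def meetE (i j : ℕ) : Exp :=
  .sum false 50 <| (onE (.var i) (.var 50)).and (onE (.var j) (.var 50))

/-- Division, remainder, and multiples of the number of nodes. -/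
def indexCmd : Cmd :=
  .seq (.tab true 3 0 (.sum false 1
    ((Exp.sum false 2 (.add (.var 1) (.lit 1))).le (.var 0)).not.not)) <|
  .seq (.tab true 4 0 (.sub (.var 0) (.sum false 1 (.get 3 (.var 0))))) <|
  .tab false 5 0 (.sum false 1 (.var 0))

/-- Distances in the tree. -/
def distCmd : Cmd :=
  .seq (.tab true 6 0 ((Exp.get 3 (.var 0)).eq (.get 4 (.var 0)))) <|
  .rep <| .seq (.tab true 7 0 (.add (.get 7 (.var 0)) (Exp.get 6 (.var 0)).not)) <|
    .tab true 6 0 (.add (.get 6 (.var 0)) (.sum false 1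
      ((matE 6 (.get 3 (.var 0)) (.var 1)).and (matE 1 (.var 1) (.get 4 (.var 0))))))

/-- The first neighbor of a leaf. -/
def rootE : Exp :=
  .argmax false 0 (.sum false 1 ((matE 1 (.var 1) (.var 0)).and
    ((Exp.lit 1).eq (.sum false 2 (matE 1 (.var 1) (.var 2)).not.not))))

/-- The parent of the node `x₀` with respect to the root `x₁₀`. -/
def parentE : Exp :=
  .argmax false 1 (.add (((Exp.var 0).eq (.var 10)).and ((Exp.var 1).eq (.var 0)))
    ((matE 1 (.var 0) (.var 1)).and (pathE (.var 0) (.var 10) (.var 1))))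

/-- The root, a neighbor of a leaf, and the parents of the nodes. -/
def rootCmd : Cmd := .seq (.set 10 rootE) (.tab false 8 0 parentE)

/-- The first link. -/
def startCmd : Cmd :=
  .seq (.set 2 (.argmax true 0 (linkE (.var 0)))) <|
  .tab true 2 0 ((Exp.var 0).eq (.var 2))

/-- The links that meet a member of the table `a`. -/
def levelCmd (a b : ℕ) : Cmd :=
  .tab true b 1 ((linkE (.var 1)).and (.sum true 0 ((Exp.get a (.var 0)).and (meetE 0 1))))

/-- The uncovered nodes `x₁` hit by the reachable link `i`. -/
def freshE (i : ℕ) : Exp := (Exp.get 13 (.var i)).and ((Exp.get 9 (.var 1)).not.and (hitE i 1))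

/-- The node `x₁` is covered. -/
def coveredE : Exp := .sum true 0 ((Exp.get 2 (.var 0)).and (hitE 0 1))

/-- A reachable link that hits as many uncovered nodes as possible. -/
def bestE : Exp := .argmax true 0 (.sum false 1 (freshE 0).not.not)

/-- A member of the table `a` that meets the link `i`. -/
def backE (a i : ℕ) : Exp := .argmax true 0 ((Exp.get a (.var 0)).and (meetE 0 i))

/-- The pair `x₀` belongs to the solution after a step. -/
def nextE : Exp :=
  .add (.get 2 (.var 0)) ((Exp.var 6).and (.add
    (.add ((Exp.var 0).eq (.var 5)) ((Exp.var 0).eq (.var 4)))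
    (.add ((Exp.var 0).eq (.var 3)) ((Exp.var 0).eq (.var 2)))))

/-- One step of the greedy algorithm. -/
def stepCmd : Cmd :=
  .seq (.tab false 9 1 coveredE) <|
  .seq (levelCmd 2 10) <|
  .seq (levelCmd 10 11) <|
  .seq (levelCmd 11 12) <|
  .seq (levelCmd 12 13) <|
  .seq (.set 2 bestE) <|
  .seq (.set 3 (backE 12 2)) <|
  .seq (.set 4 (backE 11 3)) <|
  .seq (.set 5 (backE 10 4)) <|
  .seq (.set 6 (.sum false 1 (freshE 2).not.not)) <|
  .tab true 2 0 nextE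

/-- The approximation algorithm. -/
def greedyCmd : Cmd :=
  .seq indexCmd (.seq distCmd (.seq rootCmd (.seq startCmd (.rep stepCmd))))

/-! ### Tables and the meaning of the expressions over them -/

variable {n : ℕ} {G T : SimpleGraph (Fin n)}

/-- The input and the index tables. -/
structure IndexTables (G T : SimpleGraph (Fin n)) (A : ℕ → ℕ → ℕ) : Prop where
  graph : ∀ q : Fin n × Fin n, A 0 (idx q) ≠ 0 ↔ G.Adj q.1 q.2
  tree : ∀ q : Fin n × Fin n, A 1 (idx q) ≠ 0 ↔ T.Adj q.1 q.2
  div : ∀ q : Fin n × Fin n, A 3 (idx q) = q.1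
  mod : ∀ q : Fin n × Fin n, A 4 (idx q) = q.2
  mul : ∀ v : Fin n, A 5 v = v * n

/-- Table `2` is exempt, since it holds the current solution and is rewritten in every step. -/
theorem IndexTables.congr {A A' : ℕ → ℕ → ℕ} (h : IndexTables G T A)
    (hA : ∀ a < 6, a ≠ 2 → A' a = A a) : IndexTables G T A' := by
  refine ⟨?_, ?_, ?_, ?_, ?_⟩
  · rw [hA 0 (by omega) (by omega)]; exact h.graph
  · rw [hA 1 (by omega) (by omega)]; exact h.tree
  · rw [hA 3 (by omega) (by omega)]; exact h.div
  · rw [hA 4 (by omega) (by omega)]; exact h.mod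
  · rw [hA 5 (by omega) (by omega)]; exact h.mul

/-- All tables that the greedy algorithm uses. -/
structure Tables (G T : SimpleGraph (Fin n)) (par : Fin n → Fin n) (A : ℕ → ℕ → ℕ) : Prop extends
    IndexTables G T A where
  dist : ∀ q : Fin n × Fin n, A 7 (idx q) = T.dist q.1 q.2
  parent : ∀ v : Fin n, A 8 v = par v

theorem Tables.congr {par : Fin n → Fin n} {A A' : ℕ → ℕ → ℕ} (h : Tables G T par A)
    (hA : ∀ a < 9, a ≠ 2 → A' a = A a) : Tables G T par A' where
  toIndexTables := h.toIndexTables.congr fun a ha h2 => hA a (by omega) h2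
  dist := by rw [hA 7 (by omega) (by omega)]; exact h.dist
  parent := by rw [hA 8 (by omega) (by omega)]; exact h.parent

section Eval

variable {A : ℕ → ℕ → ℕ} {ρ : ℕ → ℕ} {par : Fin n → Fin n}

theorem IndexTables.eval_pair (h : IndexTables G T A) {e f : Exp} {u v : Fin n}
    (he : e.eval n A ρ = u) (hf : f.eval n A ρ = v) :
    (Exp.add (.get 5 e) f).eval n A ρ = idx (u, v) := by
  simp only [Exp.eval, he, hf, h.mul]
  rfl

theorem IndexTables.eval_matE (h : IndexTables G T A) {a : ℕ} {e f : Exp} {u v : Fin n}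
    (he : e.eval n A ρ = u) (hf : f.eval n A ρ = v) :
    (matE a e f).eval n A ρ = A a (idx (u, v)) := by
  rw [← h.eval_pair he hf]
  rfl

theorem holds_pathE (h : IndexTables G T A)
    (hd : ∀ q : Fin n × Fin n, A 7 (idx q) = T.dist q.1 q.2) {e f g : Exp} {a b w : Fin n}
    (he : e.eval n A ρ = a) (hf : f.eval n A ρ = b) (hg : g.eval n A ρ = w) :
    (pathE e f g).Holds n A ρ ↔ OnPath T a b w := by
  rw [pathE, holds_eq]
  simp only [Exp.eval, h.eval_matE he hg, h.eval_matE hg hf, h.eval_matE he hf, hd]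
  rfl

theorem Tables.holds_onE (h : Tables G T par A) {e g : Exp} {q : Fin n × Fin n} {w : Fin n}
    (he : e.eval n A ρ = idx q) (hg : g.eval n A ρ = w) :
    (onE e g).Holds n A ρ ↔ OnPath T q.1 q.2 w := by
  refine holds_pathE h.toIndexTables h.dist ?_ ?_ hg
  · simp only [Exp.eval, he, h.div]
  · simp only [Exp.eval, he, h.mod]

theorem IndexTables.holds_linkE (h : IndexTables G T A) {e : Exp} {q : Fin n × Fin n}
    (he : e.eval n A ρ = idx q) : (linkE e).Holds n A ρ ↔ Link G T q := by
  rw [linkE, holds_and, holds_not, holds_get, holds_get, he, h.graph, h.tree]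
  rfl

theorem Tables.holds_hitE (h : Tables G T par A) {i v : ℕ} (hi : i ≠ 50) (hv : v ≠ 50)
    {q : Fin n × Fin n} {w : Fin n} (hq : ρ i = idx q) (hw : ρ v = w) :
    (hitE i v).Holds n A ρ ↔ Hits G T par q w := by
  rw [hitE, holds_add, holds_sum, exists_lt_bound_false, Hits]
  refine or_congr (h.holds_onE hq ?_) (exists_congr fun u => ?_)
  · simp only [Exp.eval, hw, h.parent]
  · have h50 : (Exp.var 50).eval n A (Function.update ρ 50 u) = u := by simp [Exp.eval]
    have hv' : (Exp.var v).eval n A (Function.update ρ 50 u) = w := by simp [Exp.eval, hv, hw]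
    rw [holds_and, holds_and]
    refine and_congr (h.holds_onE ?_ h50) (and_congr (h.holds_linkE (h.eval_pair h50 hv')) ?_)
    · simp [Exp.eval, hi, hq]
    · refine holds_pathE h.toIndexTables h.dist h50 hv' ?_
      rw [Exp.eval, hv', h.parent]

theorem Tables.holds_meetE (h : Tables G T par A) {i j : ℕ} (hi : i ≠ 50) (hj : j ≠ 50)
    {q q' : Fin n × Fin n} (hq : ρ i = idx q) (hq' : ρ j = idx q') :
    (meetE i j).Holds n A ρ ↔ Meets T q q' := by
  rw [meetE, holds_sum, exists_lt_bound_false, Meets]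
  refine exists_congr fun u => ?_
  rw [holds_and]
  refine and_congr (h.holds_onE ?_ ?_) (h.holds_onE ?_ ?_)
  · simp [Exp.eval, hi, hq]
  · simp [Exp.eval]
  · simp [Exp.eval, hj, hq']
  · simp [Exp.eval]

end Eval

/-! ### Correctness of the preparation -/

/-- The quotient `i / n` is the number of `v` with `(v + 1) * n ≤ i`, and the remainder subtracts
`n` copies of it; the products are bounded sums. Table `7` is tracked because the distances are
accumulated there from zero. -/
theorem indexCmd_spec {m : Mem} (hG : ∀ q : Fin n × Fin n, m.2 0 (idx q) ≠ 0 ↔ G.Adj q.1 q.2)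
    (hT : ∀ q : Fin n × Fin n, m.2 1 (idx q) ≠ 0 ↔ T.Adj q.1 q.2) :
    IndexTables G T (indexCmd.exec n m).2 ∧ (indexCmd.exec n m).2 7 = m.2 7 := by
  simp only [indexCmd, Cmd.exec_seq]
  have h3 : ∀ q : Fin n × Fin n, ((Cmd.tab true 3 0 (.sum false 1
      ((Exp.sum false 2 (.add (.var 1) (.lit 1))).le (.var 0)).not.not)).exec n m).2 3 (idx q)
        = q.1 := by
    intro q
    rw [Cmd.exec_tab_self (idx_lt q), eval_count (P := fun v => v < q.1)]
    · refine Eq.trans (congrArg card ?_) (Fin.card_Iio q.1)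
      ext
      simp
    · intro v
      rw [holds_le]
      simp only [Exp.eval, bound]
      simp only [Function.update_self, sum_const, card_range, smul_eq_mul, ne_eq,
        not_false_eq_true, Function.update_of_ne, zero_ne_one, OfNat.one_ne_ofNat]
      have hn := q.1.pos
      rw [mul_comm, ← Nat.le_div_iff_mul_le hn, idx_div]
      exact Nat.succ_le_iff
  have h3' := fun a (ha : a ≠ 3) => Cmd.exec_tab_ne (n := n) (m := m) (b := true) (x := 0)
    (e := .sum false 1 ((Exp.sum false 2 (.add (.var 1) (.lit 1))).le (.var 0)).not.not) ha
  generalize (Cmd.tab true 3 0 (.sum false 1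
      ((Exp.sum false 2 (.add (.var 1) (.lit 1))).le (.var 0)).not.not)).exec n m = m1 at *
  have h4 : ∀ q : Fin n × Fin n, ((Cmd.tab true 4 0
      (.sub (.var 0) (.sum false 1 (.get 3 (.var 0))))).exec n m1).2 4 (idx q) = q.2 := by
    intro q
    rw [Cmd.exec_tab_self (idx_lt q)]
    simp [Exp.eval, bound, h3]
    rw [idx, mul_comm]
    omega
  have h4' := fun a (ha : a ≠ 4) => Cmd.exec_tab_ne (n := n) (m := m1) (b := true) (x := 0)
    (e := .sub (.var 0) (.sum false 1 (.get 3 (.var 0)))) ha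
  generalize (Cmd.tab true 4 0
      (.sub (.var 0) (.sum false 1 (.get 3 (.var 0))))).exec n m1 = m2 at *
  refine ⟨⟨?_, ?_, ?_, ?_, fun v => ?_⟩, ?_⟩
  · rw [Cmd.exec_tab_ne (by omega), h4' 0 (by omega), h3' 0 (by omega)]
    exact hG
  · rw [Cmd.exec_tab_ne (by omega), h4' 1 (by omega), h3' 1 (by omega)]
    exact hT
  · rw [Cmd.exec_tab_ne (by omega), h4' 3 (by omega)]
    exact h3
  · rw [Cmd.exec_tab_ne (by omega)]
    exact h4
  · rw [Cmd.exec_tab_self v.2]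
    simp [Exp.eval, bound, mul_comm]
  · rw [Cmd.exec_tab_ne (by omega), h4' 7 (by omega), h3' 7 (by omega)]

theorem dist_le_succ_iff (hT : T.Connected) {u v : Fin n} {k : ℕ} :
    T.dist u v ≤ k + 1 ↔ T.dist u v ≤ k ∨ ∃ w, T.dist u w ≤ k ∧ T.Adj w v := by
  constructor
  · intro h
    by_cases hk : T.dist u v ≤ k
    · exact .inl hk
    right
    obtain ⟨p, hp⟩ := hT.exists_walk_length_eq_dist u v
    have hnil : ¬ p.Nil := fun hn => by
      have := Walk.length_eq_zero_iff.2 hn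
      omega
    refine ⟨p.penultimate, (dist_le p.dropLast).trans ?_, p.adj_penultimate hnil⟩
    simp
    omega
  · rintro (h | ⟨w, h1, h2⟩)
    · omega
    · have h3 := hT.dist_triangle (u := u) (v := w) (w := v)
      have h4 : T.dist w v = 1 := dist_eq_one_iff_adj.2 h2
      omega

theorem distCmd_spec (hT : T.IsTree) {m : Mem} (hm : IndexTables G T m.2) (h7 : m.2 7 = 0) :
    IndexTables G T (distCmd.exec n m).2 ∧
      ∀ q : Fin n × Fin n, (distCmd.exec n m).2 7 (idx q) = T.dist q.1 q.2 := by
  -- After `k` rounds table `6` marks the pairs at distance at most `k`, and table `7` counts the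
  -- rounds that began with the pair unmarked.
  let P : ℕ → Mem → Prop := fun k m => IndexTables G T m.2 ∧
    (∀ q : Fin n × Fin n, m.2 6 (idx q) ≠ 0 ↔ T.dist q.1 q.2 ≤ k) ∧
    ∀ q : Fin n × Fin n, m.2 7 (idx q) = min k (T.dist q.1 q.2)
  have hP : P n (distCmd.exec n m) := by
    rw [distCmd, Cmd.exec_seq]
    refine Cmd.exec_rep P ⟨?_, fun q => ?_, fun q => ?_⟩ ?_
    · exact hm.congr fun a ha _ => Cmd.exec_tab_ne (by omega)
    · rw [Cmd.exec_tab_self (idx_lt q)]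
      change Exp.Holds _ _ _ _ ↔ _
      rw [holds_eq]
      simp only [Exp.eval, Function.update_self, hm.div, hm.mod, Nat.le_zero,
        hT.connected.dist_eq_zero_iff, Fin.ext_iff]
    · rw [Cmd.exec_tab_ne (by omega), h7]
      simp
    · rintro k m ⟨hm, h6, h7⟩
      rw [Cmd.exec_seq]
      refine ⟨?_, fun q => ?_, fun q => ?_⟩
      · exact hm.congr fun a ha _ => by
          rw [Cmd.exec_tab_ne (by omega), Cmd.exec_tab_ne (by omega)]
      · rw [Cmd.exec_tab_self (idx_lt q)]
        have hm' : IndexTables G T ((Cmd.tab true 7 0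
            (.add (.get 7 (.var 0)) (Exp.get 6 (.var 0)).not)).exec n m).2 :=
          hm.congr fun a ha _ => Cmd.exec_tab_ne (by omega)
        change Exp.Holds _ _ _ _ ↔ _
        rw [holds_add, holds_get, holds_sum, exists_lt_bound_false, Cmd.exec_tab_ne (by omega),
          dist_le_succ_iff hT.connected]
        simp only [holds_and]
        refine or_congr (by simpa [Exp.eval] using h6 q) (exists_congr fun w => ?_)
        simp only [Exp.Holds]
        rw [hm'.eval_matE (u := q.1) (v := w), hm'.eval_matE (u := w) (v := q.2), hm'.tree,
          Cmd.exec_tab_ne (by omega), h6]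
        all_goals simp [Exp.eval, hm'.div, hm'.mod]
      · rw [Cmd.exec_tab_ne (by omega), Cmd.exec_tab_self (idx_lt q)]
        have := h6 q
        simp only [Exp.eval, Exp.not, Function.update_self, h7]
        omega
  refine ⟨hP.1, fun q => ?_⟩
  -- Paths have fewer than `n` edges, so `n` rounds reach every distance.
  rw [hP.2.2 q, min_eq_right]
  obtain ⟨p, hp, hl⟩ := hT.connected.exists_path_of_dist q.1 q.2
  have := hp.length_lt
  rw [Fintype.card_fin] at this
  omega

theorem exists_leaf (hT : T.IsTree) (hn : 2 ≤ n) :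
    ∃ c l, T.Adj l c ∧ (univ.filter fun x => T.Adj l x).card = 1 := by
  have : Nontrivial (Fin n) := Fin.nontrivial_iff_two_le.2 hn
  obtain ⟨l, hl⟩ := hT.exists_vert_degree_one_of_nontrivial
  rw [← card_neighborFinset_eq_degree, neighborFinset_eq_filter] at hl
  obtain ⟨c, hc⟩ := card_eq_one.1 hl
  have : c ∈ univ.filter fun x => T.Adj l x := hc ▸ mem_singleton_self c
  exact ⟨c, l, (mem_filter.1 this).2, hl⟩

theorem rootCmd_spec (hT : T.IsTree) (hn : 2 ≤ n) {m : Mem} (hm : IndexTables G T m.2)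
    (hd : ∀ q : Fin n × Fin n, m.2 7 (idx q) = T.dist q.1 q.2) :
    ∃ l c par, (∀ x, T.Adj l x → x = c) ∧ IsParent T c par ∧
      Tables G T par (rootCmd.exec n m).2 := by
  obtain ⟨c, hc, l, hlc, hl⟩ := argmax_node_holds (n := n) (A := m.2) (ρ := m.1) (x := 0)
    (e := .sum false 1 ((matE 1 (.var 1) (.var 0)).and
      ((Exp.lit 1).eq (.sum false 2 (matE 1 (.var 1) (.var 2)).not.not))))
    (P := fun c => ∃ l, T.Adj l c ∧ (univ.filter fun x => T.Adj l x).card = 1)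
    (by
      intro c
      rw [holds_sum, exists_lt_bound_false]
      refine exists_congr fun l => ?_
      rw [holds_and, holds_eq]
      refine and_congr ?_ ?_
      · simp only [Exp.Holds]
        rw [hm.eval_matE (u := l) (v := c), hm.tree]
        all_goals simp [Exp.eval]
      · rw [eval_count (P := fun x => T.Adj l x)]
        · exact eq_comm
        · intro x
          simp only [Exp.Holds]
          rw [hm.eval_matE (u := l) (v := x), hm.tree]
          all_goals simp [Exp.eval])
    (exists_leaf hT hn)
  have hleaf : ∀ x, T.Adj l x → x = c := by
    intro x hx
    obtain ⟨y, hy⟩ := card_eq_one.1 hl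
    have h1 : x ∈ univ.filter fun x => T.Adj l x := mem_filter.2 ⟨mem_univ _, hx⟩
    have h2 : c ∈ univ.filter fun x => T.Adj l x := mem_filter.2 ⟨mem_univ _, hlc⟩
    rw [hy, mem_singleton] at h1 h2
    rw [h1, h2]
  obtain ⟨m1, e1⟩ : ∃ m1, m1 = (Cmd.set 10 rootE).exec n m := ⟨_, rfl⟩
  have hc1 : m1.1 10 = c := by rw [e1, Cmd.exec_set_self]; exact hc
  have hm1 : m1.2 = m.2 := by rw [e1, Cmd.exec_set_arr]
  have hpar : ∀ v : Fin n, ∃ p : Fin n, parentE.eval n m1.2 (Function.update m1.1 0 v) = p ∧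
      (v = c ∧ p = v ∨ T.Adj v p ∧ OnPath T v c p) := by
    intro v
    refine argmax_node_holds (fun p => ?_) (exists_isParent hT c v)
    rw [hm1, holds_add, holds_and, holds_and, holds_eq, holds_eq]
    refine or_congr (and_congr ?_ ?_) (and_congr ?_ ?_)
    · simp [Exp.eval, hc1, Fin.ext_iff]
    · simp [Exp.eval, Fin.ext_iff]
    · simp only [Exp.Holds]
      rw [hm.eval_matE (u := v) (v := p), hm.tree]
      all_goals simp [Exp.eval]
    · refine holds_pathE hm hd ?_ ?_ ?_
      all_goals simp [Exp.eval, hc1]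
  choose par hpar using hpar
  refine ⟨l, c, par, hleaf, fun v => (hpar v).2, ?_⟩
  rw [rootCmd, Cmd.exec_seq, ← e1]
  refine ⟨hm.congr fun a ha _ => by rw [Cmd.exec_tab_ne (by omega), hm1], ?_, fun v => ?_⟩
  · rw [Cmd.exec_tab_ne (by omega), hm1]
    exact hd
  · rw [Cmd.exec_tab_self v.2, (hpar v).1]

theorem startCmd_spec {par : Fin n → Fin n} {m : Mem} (hm : Tables G T par m.2)
    (hlink : ∃ q, Link G T q) : ∃ q, Link G T q ∧ Tables G T par (startCmd.exec n m).2 ∧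
      ∀ q', (startCmd.exec n m).2 2 (idx q') ≠ 0 ↔ q' ∈ ({q} : Finset (Fin n × Fin n)) := by
  obtain ⟨q, hq, hl⟩ := argmax_pair_holds (A := m.2) (ρ := m.1) (x := 0) (e := linkE (.var 0))
    (P := Link G T) (fun q => hm.holds_linkE (by simp [Exp.eval])) hlink
  refine ⟨q, hl, ?_, fun q' => ?_⟩
  · refine hm.congr fun a ha h2 => ?_
    rw [startCmd, Cmd.exec_seq, Cmd.exec_tab_ne h2, Cmd.exec_set_arr]
  · rw [startCmd, Cmd.exec_seq, Cmd.exec_tab_self (idx_lt q')]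
    change Exp.Holds _ _ _ _ ↔ _
    rw [holds_eq]
    have h2 := Cmd.exec_set_self (n := n) (m := m) (x := 2) (e := .argmax true 0 (linkE (.var 0)))
    rw [hq] at h2
    simp [Exp.eval, h2, idx_inj]

/-! ### Correctness of a greedy step -/

section Step

variable {par : Fin n → Fin n} {m : Mem}

theorem levelCmd_spec (hm : Tables G T par m.2) {a : ℕ} {S : Fin n × Fin n → Prop}
    (hS : ∀ q, m.2 a (idx q) ≠ 0 ↔ S q) (b : ℕ) (q : Fin n × Fin n) :
    ((levelCmd a b).exec n m).2 b (idx q) ≠ 0 ↔ Link G T q ∧ ∃ j, S j ∧ Meets T j q := by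
  rw [levelCmd, Cmd.exec_tab_self (idx_lt q)]
  change Exp.Holds _ _ _ _ ↔ _
  rw [holds_and, holds_sum, exists_lt_bound_true]
  refine and_congr (hm.holds_linkE (by simp [Exp.eval])) (exists_congr fun j => ?_)
  rw [holds_and, holds_get]
  refine and_congr ?_ (hm.holds_meetE (by omega) (by omega) (by simp) (by simp))
  simpa [Exp.eval] using hS j

theorem holds_coveredE (hm : Tables G T par m.2) {C : Finset (Fin n × Fin n)}
    (hC : ∀ q, m.2 2 (idx q) ≠ 0 ↔ q ∈ C) (v : Fin n) :
    coveredE.Holds n m.2 (Function.update m.1 1 v) ↔ Greedy.Covered (Hits G T par) C v := by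
  rw [coveredE, holds_sum, exists_lt_bound_true]
  refine exists_congr fun q => ?_
  rw [holds_and, holds_get]
  refine and_congr ?_ (hm.holds_hitE (by omega) (by omega) (by simp) (by simp))
  simpa [Exp.eval] using hC q

/-- Unreachable pairs count as `0`. A maximum over all pairs is therefore a maximum over the fourth
level, and the value `0` means that no reachable link gains anything. -/
theorem eval_fresh {A : ℕ → ℕ → ℕ} (hm : Tables G T par A) {C : Finset (Fin n × Fin n)}
    (h9 : ∀ v : Fin n, A 9 v ≠ 0 ↔ Greedy.Covered (Hits G T par) C v)
    (h13 : ∀ q, A 13 (idx q) ≠ 0 ↔ Greedy.Level (Link G T) (Meets T) C 4 q) {ρ : ℕ → ℕ} {i : ℕ}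
    (hi : i ≠ 1) (hi' : i ≠ 50) {q : Fin n × Fin n} (hq : ρ i = idx q) :
    (Exp.sum false 1 (freshE i).not.not).eval n A ρ =
      if Greedy.Level (Link G T) (Meets T) C 4 q then (Greedy.fresh (Hits G T par) C q).card
      else 0 := by
  rw [eval_count (P := fun v => Greedy.Level (Link G T) (Meets T) C 4 q ∧
    (¬ Greedy.Covered (Hits G T par) C v ∧ Hits G T par q v))]
  · split_ifs with h
    · simp only [h, true_and]
      rfl
    · simp [h]
  · intro v
    rw [freshE, holds_and, holds_and, holds_not, holds_get, holds_get]
    refine and_congr ?_ (and_congr (not_congr ?_)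
      (hm.holds_hitE hi' (by omega) (by simp [hi, hq]) (by simp)))
    · simpa [Exp.eval, hi, hq] using h13 q
    · simpa [Exp.eval] using h9 v

theorem eval_back {A : ℕ → ℕ → ℕ} (hm : Tables G T par A) {a : ℕ} {S : Fin n × Fin n → Prop}
    (hS : ∀ q, A a (idx q) ≠ 0 ↔ S q) {ρ : ℕ → ℕ} {i : ℕ} (hi : i ≠ 0) (hi' : i ≠ 50)
    {q : Fin n × Fin n} (hq : ρ i = idx q) (h : ∃ j, S j ∧ Meets T j q) :
    ∃ j, (backE a i).eval n A ρ = idx j ∧ S j ∧ Meets T j q := by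
  refine argmax_pair_holds (fun j => ?_) h
  rw [holds_and, holds_get]
  refine and_congr ?_ (hm.holds_meetE (by omega) hi' (by simp) (by simp [hi, hq]))
  simpa [Exp.eval] using hS j

theorem stepCmd_spec (hn : 0 < n) (hm : Tables G T par m.2) {C : Finset (Fin n × Fin n)}
    (hC : ∀ q, m.2 2 (idx q) ≠ 0 ↔ q ∈ C) : ∃ C',
      Greedy.Step (Link G T) (Meets T) (Hits G T par) C C' ∧
      Tables G T par (stepCmd.exec n m).2 ∧
      ∀ q, (stepCmd.exec n m).2 2 (idx q) ≠ 0 ↔ q ∈ C' := by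
  simp only [stepCmd, Cmd.exec_seq]
  obtain ⟨m1, e1⟩ : ∃ x, x = (Cmd.tab false 9 1 coveredE).exec n m := ⟨_, rfl⟩
  rw [← e1]
  have f1 : ∀ a, a ≠ 9 → m1.2 a = m.2 a := fun a ha => by rw [e1, Cmd.exec_tab_ne ha]
  have t1 : Tables G T par m1.2 := hm.congr fun a ha _ => f1 a (by omega)
  have h9 : ∀ v : Fin n, m1.2 9 v ≠ 0 ↔ Greedy.Covered (Hits G T par) C v := fun v => by
    rw [e1, Cmd.exec_tab_self v.2]
    exact holds_coveredE hm hC v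
  have h2 : ∀ q, m1.2 2 (idx q) ≠ 0 ↔ Greedy.Level (Link G T) (Meets T) C 0 q := fun q => by
    rw [f1 2 (by omega)]
    exact hC q
  clear e1
  obtain ⟨m2, e2⟩ : ∃ x, x = (levelCmd 2 10).exec n m1 := ⟨_, rfl⟩
  rw [← e2]
  have f2 : ∀ a, a ≠ 10 → m2.2 a = m1.2 a := fun a ha => by rw [e2, levelCmd, Cmd.exec_tab_ne ha]
  have t2 : Tables G T par m2.2 := t1.congr fun a ha _ => f2 a (by omega)
  have h10 : ∀ q, m2.2 10 (idx q) ≠ 0 ↔ Greedy.Level (Link G T) (Meets T) C 1 q := fun q => by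
    rw [e2]
    exact levelCmd_spec t1 h2 10 q
  clear e2
  obtain ⟨m3, e3⟩ : ∃ x, x = (levelCmd 10 11).exec n m2 := ⟨_, rfl⟩
  rw [← e3]
  have f3 : ∀ a, a ≠ 11 → m3.2 a = m2.2 a := fun a ha => by rw [e3, levelCmd, Cmd.exec_tab_ne ha]
  have t3 : Tables G T par m3.2 := t2.congr fun a ha _ => f3 a (by omega)
  have h11 : ∀ q, m3.2 11 (idx q) ≠ 0 ↔ Greedy.Level (Link G T) (Meets T) C 2 q := fun q => by
    rw [e3]
    exact levelCmd_spec t2 h10 11 q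
  clear e3
  obtain ⟨m4, e4⟩ : ∃ x, x = (levelCmd 11 12).exec n m3 := ⟨_, rfl⟩
  rw [← e4]
  have f4 : ∀ a, a ≠ 12 → m4.2 a = m3.2 a := fun a ha => by rw [e4, levelCmd, Cmd.exec_tab_ne ha]
  have t4 : Tables G T par m4.2 := t3.congr fun a ha _ => f4 a (by omega)
  have h12 : ∀ q, m4.2 12 (idx q) ≠ 0 ↔ Greedy.Level (Link G T) (Meets T) C 3 q := fun q => by
    rw [e4]
    exact levelCmd_spec t3 h11 12 q
  clear e4
  obtain ⟨m5, e5⟩ : ∃ x, x = (levelCmd 12 13).exec n m4 := ⟨_, rfl⟩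
  rw [← e5]
  have f5 : ∀ a, a ≠ 13 → m5.2 a = m4.2 a := fun a ha => by rw [e5, levelCmd, Cmd.exec_tab_ne ha]
  have t5 : Tables G T par m5.2 := t4.congr fun a ha _ => f5 a (by omega)
  have h13 : ∀ q, m5.2 13 (idx q) ≠ 0 ↔ Greedy.Level (Link G T) (Meets T) C 4 q := fun q => by
    rw [e5]
    exact levelCmd_spec t4 h12 13 q
  clear e5
  -- All facts about tables are carried forward to the memory `m5`; the commands up to the last one
  -- change only variables.
  rw [← f5 12 (by omega)] at h12
  rw [← f4 11 (by omega), ← f5 11 (by omega)] at h11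
  rw [← f3 10 (by omega), ← f4 10 (by omega), ← f5 10 (by omega)] at h10
  rw [← f2 9 (by omega), ← f3 9 (by omega), ← f4 9 (by omega), ← f5 9 (by omega)] at h9
  rw [← f2 2 (by omega), ← f3 2 (by omega), ← f4 2 (by omega), ← f5 2 (by omega)] at h2
  obtain ⟨o, ho, hmax⟩ := argmax_pair (A := m5.2) (ρ := m5.1) (x := 0)
    (e := .sum false 1 (freshE 0).not.not) hn
  simp only [eval_fresh t5 h9 h13 (i := 0) (by omega) (by omega) (Function.update_self _ _ _)]
    at hmax
  obtain ⟨m6, e6⟩ : ∃ x, x = (Cmd.set 2 bestE).exec n m5 := ⟨_, rfl⟩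
  obtain ⟨m7, e7⟩ : ∃ x, x = (Cmd.set 3 (backE 12 2)).exec n m6 := ⟨_, rfl⟩
  obtain ⟨m8, e8⟩ : ∃ x, x = (Cmd.set 4 (backE 11 3)).exec n m7 := ⟨_, rfl⟩
  obtain ⟨m9, e9⟩ : ∃ x, x = (Cmd.set 5 (backE 10 4)).exec n m8 := ⟨_, rfl⟩
  obtain ⟨m10, e10⟩ : ∃ x, x = (Cmd.set 6 (.sum false 1 (freshE 2).not.not)).exec n m9 := ⟨_, rfl⟩
  rw [← e6, ← e7, ← e8, ← e9, ← e10]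
  have a6 : m6.2 = m5.2 := by rw [e6, Cmd.exec_set_arr]
  have a7 : m7.2 = m5.2 := by rw [e7, Cmd.exec_set_arr, a6]
  have a8 : m8.2 = m5.2 := by rw [e8, Cmd.exec_set_arr, a7]
  have a9 : m9.2 = m5.2 := by rw [e9, Cmd.exec_set_arr, a8]
  have a10 : m10.2 = m5.2 := by rw [e10, Cmd.exec_set_arr, a9]
  have v6 : m6.1 2 = idx o := by rw [e6, Cmd.exec_set_self]; exact ho
  have v7 : m7.1 2 = idx o := by rw [e7, Cmd.exec_set_ne (by omega), v6]
  have v9 : m9.1 2 = idx o := by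
    rw [e9, Cmd.exec_set_ne (by omega), e8, Cmd.exec_set_ne (by omega), v7]
  have v10 : m10.1 2 = idx o := by rw [e10, Cmd.exec_set_ne (by omega), v9]
  have w10 : m10.1 6 = if Greedy.Level (Link G T) (Meets T) C 4 o then
      (Greedy.fresh (Hits G T par) C o).card else 0 := by
    rw [e10, Cmd.exec_set_self, a9]
    exact eval_fresh t5 h9 h13 (by omega) (by omega) v9
  have tables : Tables G T par ((Cmd.tab true 2 0 nextE).exec n m10).2 :=
    t5.congr fun a ha ha2 => by rw [Cmd.exec_tab_ne ha2, a10]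
  have hnext : ∀ q, ((Cmd.tab true 2 0 nextE).exec n m10).2 2 (idx q) ≠ 0 ↔
      q ∈ C ∨ m10.1 6 ≠ 0 ∧ ((idx q = m10.1 5 ∨ idx q = m10.1 4) ∨
        (idx q = m10.1 3 ∨ idx q = m10.1 2)) := by
    intro q
    rw [Cmd.exec_tab_self (idx_lt q)]
    change Exp.Holds _ _ _ _ ↔ _
    rw [nextE, holds_add, holds_get, holds_and, holds_add, holds_add, holds_add, holds_eq, holds_eq,
      holds_eq, holds_eq, holds_var, a10]
    refine or_congr ?_ ?_
    · simpa [Exp.eval, Greedy.Level] using h2 q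
    · simp [Exp.eval]
  -- Variable `6` holds the gain. If it is `0`, the possibly meaningless chain in the variables `2`
  -- to `5` is ignored.
  rcases Nat.eq_zero_or_pos (m10.1 6) with h0 | hpos
  · refine ⟨C, .inl ⟨rfl, fun i hi => ?_⟩, tables, fun q => ?_⟩
    · have := hmax i
      rw [if_pos hi, ← w10, h0] at this
      omega
    · rw [hnext, h0]
      simp
  · have h4 : Greedy.Level (Link G T) (Meets T) C 4 o := by
      by_contra h
      rw [if_neg h] at w10
      omega
    rw [if_pos h4] at w10 hmax
    -- Since the positive gain certifies that `o` is reachable, the connecting links are recovered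
    -- backwards, from the third level to the first.
    obtain ⟨q3, b3, l3, r3⟩ := eval_back (a6 ▸ t5) (a6 ▸ h12) (by omega) (by omega) v6 h4.2
    have v3 : m7.1 3 = idx q3 := by rw [e7, Cmd.exec_set_self, b3]
    obtain ⟨q2, b2, l2, r2⟩ := eval_back (a7 ▸ t5) (a7 ▸ h11) (by omega) (by omega) v3 l3.2
    have v2 : m8.1 4 = idx q2 := by rw [e8, Cmd.exec_set_self, b2]
    obtain ⟨q1, b1, l1, r1⟩ := eval_back (a8 ▸ t5) (a8 ▸ h10) (by omega) (by omega) v2 l2.2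
    have v1 : m9.1 5 = idx q1 := by rw [e9, Cmd.exec_set_self, b1]
    have x3 : m10.1 3 = idx q3 := by
      rw [e10, Cmd.exec_set_ne (by omega), e9, Cmd.exec_set_ne (by omega), e8,
        Cmd.exec_set_ne (by omega), v3]
    have x2 : m10.1 4 = idx q2 := by
      rw [e10, Cmd.exec_set_ne (by omega), e9, Cmd.exec_set_ne (by omega), v2]
    have x1 : m10.1 5 = idx q1 := by rw [e10, Cmd.exec_set_ne (by omega), v1]
    refine ⟨_, .inr ⟨q1, q2, q3, o, ⟨l1, l2, l3, h4, r1, r2, r3⟩, by omega,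
      fun i hi => ?_, rfl⟩, tables, fun q => ?_⟩
    · have := hmax i
      rwa [if_pos hi] at this
    · rw [hnext, v10, x1, x2, x3, idx_inj, idx_inj, idx_inj, idx_inj]
      simp only [mem_union, mem_insert, mem_singleton, hpos.ne', ne_eq, not_false_eq_true, true_and]
      tauto

end Step

end DomSubtree

/-! ### The approximation ratio -/

namespace DomSubtree

open RAM Finset SimpleGraph
open scoped Classical

variable {n : ℕ} {G T : SimpleGraph (Fin n)}

/-- A tree is non-empty, so it has a covering link. The bound on `F.card` absorbs additive constants
in the ratio, and the bound on `n` keeps `Real.log n` away from `0`. -/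
theorem two_le_of_isFeasible {F : Finset (Sym2 (Fin n))} (hF : IsFeasible G T F) :
    2 ≤ n ∧ 1 ≤ F.card := by
  obtain ⟨v, w, f, hf, -⟩ := hF.tree.connected.nonempty.some
  refine ⟨?_, card_pos.2 ⟨f, hf⟩⟩
  have hG := (hF.subset hf).1
  induction f with
  | _ a b =>
    exact Fin.nontrivial_iff_two_le.1 ⟨a, b, (show G.Adj a b from hG).ne⟩

theorem greedyCmd_spec (hTG : T ≤ G) (hT : T.IsTree) (hF : ∃ F, IsFeasible G T F) {m : Mem}
    (hmG : ∀ q : Fin n × Fin n, m.2 0 (idx q) ≠ 0 ↔ G.Adj q.1 q.2)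
    (hmT : ∀ q : Fin n × Fin n, m.2 1 (idx q) ≠ 0 ↔ T.Adj q.1 q.2) (h7 : m.2 7 = 0) :
    ∃ C : Finset (Fin n × Fin n), IsFeasible G T (edges C) ∧
      (∀ F, IsFeasible G T F → (C.card : ℚ) ≤ 1 + 4 * ((F.card + 1) * (harmonic n + 1))) ∧
      ∀ q, (greedyCmd.exec n m).2 2 (idx q) ≠ 0 ↔ q ∈ C := by
  obtain ⟨F₀, hF₀⟩ := hF
  have hn : 2 ≤ n := (two_le_of_isFeasible hF₀).1
  rw [greedyCmd, Cmd.exec_seq, Cmd.exec_seq, Cmd.exec_seq, Cmd.exec_seq]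
  obtain ⟨h1, h1'⟩ := indexCmd_spec hmG hmT
  obtain ⟨h2, h2'⟩ := distCmd_spec hT h1 (h1'.trans h7)
  obtain ⟨l, c, par, hl, hpar, h3⟩ := rootCmd_spec hT hn h2 h2'
  obtain ⟨O₀, -, ⟨o, ho⟩, hO₀⟩ := exists_cover hT hl hpar hF₀
  obtain ⟨q₀, hq₀, h4, h4'⟩ := startCmd_spec h3 ⟨o, hO₀.link o ho⟩
  generalize startCmd.exec n (rootCmd.exec n (distCmd.exec n (indexCmd.exec n m))) = m₀ at *
  let M : ℕ → Mem := fun k => (stepCmd.exec n)^[k] m₀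
  let C : ℕ → Finset (Fin n × Fin n) := fun k => univ.filter fun q => (M k).2 2 (idx q) ≠ 0
  have hC : ∀ k q, (M k).2 2 (idx q) ≠ 0 ↔ q ∈ C k := fun k q => by simp [C]
  have hstep : ∀ k, Tables G T par (M k).2 → Tables G T par (M (k + 1)).2 ∧
      Greedy.Step (Link G T) (Meets T) (Hits G T par) (C k) (C (k + 1)) := by
    intro k hk
    obtain ⟨C', hs, ht, hC'⟩ := stepCmd_spec (by omega) hk (hC k)
    have hM : M (k + 1) = stepCmd.exec n (M k) := Function.iterate_succ_apply' _ _ _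
    rw [← hM] at ht hC'
    have : C' = C (k + 1) := by
      ext q
      rw [← hC', hC]
    exact ⟨ht, this ▸ hs⟩
  have htab : ∀ k, Tables G T par (M k).2 := by
    intro k
    induction k with
    | zero => exact h4
    | succ k ih => exact (hstep k ih).1
  have hs := fun k => (hstep k (htab k)).2
  have hC0 : C 0 = {q₀} := by
    ext q
    rw [← hC]
    exact h4' q
  have hlink : ∀ i ∈ C 0, Link G T i := by
    rw [hC0]
    simpa using hq₀
  have hinv : ∀ k, (∀ i ∈ C k, Link G T i) ∧ (coveredForest T (edges (C k))).Connected := by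
    intro k
    induction k with
    | zero =>
      refine ⟨hlink, ?_⟩
      rw [hC0, edges_singleton]
      exact connected_singleton hT hq₀.ne
    | succ k ih => exact ⟨(hs k).isLink ih.1, connected_step hT ih.1 ih.2 (hs k)⟩
  have hne : (C 0).Nonempty := hC0 ▸ singleton_nonempty q₀
  refine ⟨C n, ?_, fun F hF => ?_, hC n⟩
  · have := (hO₀.greedy C hlink hne hs).1
    rw [Fintype.card_fin] at this
    exact isFeasible_edges hT hTG hpar (hinv n).1 (hinv n).2 this
  -- The run does not depend on a solution: `O₀` served to find a first link and to prove coverage,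
  -- while the size is compared with an arbitrary `F`.
  · obtain ⟨O, hcard, -, hO⟩ := exists_cover hT hl hpar hF
    have := (hO.greedy C hlink hne hs).2 n
    rw [Fintype.card_fin, hC0, card_singleton, Nat.cast_one] at this
    have h1 : (O.card : ℚ) ≤ F.card + 1 := by exact_mod_cast hcard
    have h2 : (0 : ℚ) ≤ harmonic n + 1 := by
      have := Greedy.harmonic_le_harmonic (Nat.zero_le n)
      rw [harmonic_zero] at this
      linarith
    nlinarith [mul_le_mul_of_nonneg_right h1 h2]

theorem matrixArray_idx (H : SimpleGraph (Fin n)) (q : Fin n × Fin n) :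
    matrixArray H (idx q) ≠ 0 ↔ H.Adj q.1 q.2 := by
  have : (∃ u v : Fin n, idx q = (u : ℕ) * n + (v : ℕ) ∧ H.Adj u v) ↔ H.Adj q.1 q.2 := by
    constructor
    · rintro ⟨u, v, h, huv⟩
      obtain rfl : q = (u, v) := idx_inj.1 h
      exact huv
    · exact fun h => ⟨q.1, q.2, rfl, h⟩
  simp [matrixArray, this]

theorem outputSet_eq {σ : State} {C : Finset (Fin n × Fin n)}
    (h : ∀ q, σ.arr 2 (idx q) ≠ 0 ↔ q ∈ C) : outputSet n σ = edges C := by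
  ext f
  simp only [outputSet, edges, mem_image, mem_filter, mem_univ, true_and]
  exact exists_congr fun q => and_congr_left fun _ => h q

/-- For `1 ≤ b` the bound is at most `17 * b + 8 * L * b`, and `17 ≤ 25 * Real.log 2 ≤ 25 * L`;
hence `33 = 25 + 8`. -/
theorem ratio_bound {a b h L : ℝ} (hb : 1 ≤ b) (hh : h ≤ 1 + L) (hL : Real.log 2 ≤ L)
    (ha : a ≤ 1 + 4 * ((b + 1) * (h + 1))) : a ≤ 33 * L * b := by
  have hlog := Real.log_two_gt_d9
  have h1 : (b + 1) * (h + 1) ≤ (b + 1) * (2 + L) :=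
    mul_le_mul_of_nonneg_left (by linarith) (by linarith)
  have h2 : (b + 1) * (2 + L) ≤ (2 * b) * (2 + L) :=
    mul_le_mul_of_nonneg_right (by linarith) (by linarith)
  have h3 : 17 * b ≤ 25 * L * b := mul_le_mul_of_nonneg_right (by linarith) (by linarith)
  linarith

end DomSubtree

/-- The Dominating Subtree problem admits approximation ratio `O(log n)`. -/
theorem theorem2 : ∃ C : ℝ, DomSubtree.AdmitsRatio (fun n => C * Real.log (n : ℝ)) := by
  obtain ⟨P, p, hP⟩ := DomSubtree.greedyCmd.exists_program
  refine ⟨33, P, p, fun n G T hTG hT => ?_⟩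
  obtain ⟨t, τ, hrun, ht, harr⟩ := hP n
    (fun a => (DomSubtree.inputState G T).arr (RAM.slot a)) (DomSubtree.inputState G T)
    (fun _ => rfl) (fun _ => rfl)
  refine ⟨t, τ, hrun, ht, fun hF => ?_⟩
  -- `slot` fixes `0`, `1` and `2`, so the input and output tables are the machine arrays with these
  -- numbers; table `7` is the array `8`, which is zero at the start.
  obtain ⟨C, hfeas, hcard, hC⟩ := DomSubtree.greedyCmd_spec hTG hT hF
    (m := (fun _ => 0, fun a => (DomSubtree.inputState G T).arr (RAM.slot a)))
    (DomSubtree.matrixArray_idx G) (DomSubtree.matrixArray_idx T) rfl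
  rw [← harr] at hC
  rw [DomSubtree.outputSet_eq hC]
  refine ⟨hfeas, fun F hF => ?_⟩
  obtain ⟨hn, hF1⟩ := DomSubtree.two_le_of_isFeasible hF
  refine DomSubtree.ratio_bound (by exact_mod_cast hF1) (harmonic_le_one_add_log n)
    (Real.log_le_log (by norm_num) (by exact_mod_cast hn)) ?_
  have h1 : ((DomSubtree.edges C).card : ℚ) ≤ C.card := by exact_mod_cast DomSubtree.card_edges_le C
  exact_mod_cast h1.trans (hcard F hF)
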